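/- Let $a_1>1/2$ and $b_1>0$. Let the target be the log-transformed inverse-gamma distribution, i.e. the law of $\theta=\log X$ with $X\sim\mathrm{IG}(a_1,b_1)$ (equivalently $e^{-\theta}\sim\mathrm{Gamma}(a_1,\text{rate } b_1)$), with density $$p(\theta)=\frac{b_1^{a_1}}{\Gamma(a_1)}\exp\!\left(-a_1\theta-b_1e^{-\theta}\right),\qquad \theta\in\mathbb R .$$ It has a finite mean $\mu_*$, a finite variance $\sigma_*^2$ and a unique mode $m_*$. For $q=\mathrm N(\mu,\sigma^2)$ with density $q(\theta)$, $\mu\in\mathbb R$, $\sigma^2>0$, consider the Kullback--Leibler divergence $\mathrm{KL}(q\|p)=\int q\log(q/p)\,d\theta$, the Fisher divergence (FD) $F(q\|p)=\int q\,\{\frac{d}{d\theta}\log(q/p)\}^2d\theta$ and the score-based divergence (SD) $S(q\|p)=\sigma^2F(q\|p)$. Let $W_0$ be the principal branch of the Lambert W function. Then, as functions of $(\mu,\sigma^2)\in\mathbb R\times(0,\infty)$: 1. $\mathrm{KL}$ has the unique global minimizer $\hat\sigma^2_{\mathrm{KL}}=\frac1{a_1}$, $\hat\mu_{\mathrm{KL}}=\log\frac{b_1}{a_1}+\frac1{2a_1}$.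 2. SD has the unique global minimizer $\hat\sigma^2_{\mathrm S}=1-W_0\!\left(\frac{e\,a_1^2}{(a_1+1)^2}\right)$, $\hat\mu_{\mathrm S}=\log\frac{b_1}{a_1+1}+\frac32\hat\sigma^2_{\mathrm S}$. 3. FD has the unique local minimizer $\hat\sigma^2_{\mathrm F}=-2W_0\!\left(-\frac1{2(a_1+1)}\right)$, $\hat\mu_{\mathrm F}=\log\frac{b_1}{a_1+1}+\frac32\hat\sigma^2_{\mathrm F}$. If $a_1\ge\sqrt e-1$, it is also the unique global minimizer; if $a_1<\sqrt e-1$, FD has no global minimizer. Moreover $$\hat\sigma^2_{\mathrm S}<\hat\sigma^2_{\mathrm F}<\hat\sigma^2_{\mathrm{KL}}<\sigma_*^2,\qquad m_*<\hat\mu_{\mathrm S}<\hat\mu_{\mathrm F}<\hat\mu_{\mathrm{KL}}<\mu_* .$$ -/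

import Mathlib

open MeasureTheory ProbabilityTheory
open scoped ENNReal NNReal

noncomputable section

/-- The density of the log-transformed inverse gamma distribution with shape `a` and scale `b`,
that is, of `θ = log X` with `X ∼ IG(a, b)`, equivalently `exp (-θ) ∼ Gamma(a, b)` (rate `b`). -/
def logInvGammaPDF (a b θ : ℝ) : ℝ :=
  b ^ a / Real.Gamma a * Real.exp (-a * θ - b * Real.exp (-θ))

/-- The log-transformed inverse gamma distribution. -/
def logInvGamma (a b : ℝ) : Measure ℝ :=
  volume.withDensity fun θ => ENNReal.ofReal (logInvGammaPDF a b θ)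

/-- `m` is a mode of the density `p`: a global maximizer. -/
def IsMode (p : ℝ → ℝ) (m : ℝ) : Prop := IsMaxOn p Set.univ m

/-- The weighted Fisher divergence `∫ q(θ) ‖∇ log (q(θ) / p(θ))‖²_M dθ` of univariate densities, with
`‖z‖²_M = M z²`, as an extended nonnegative number. -/
def weightedFisherDiv (M : ℝ≥0) (q p : ℝ → ℝ) : ℝ≥0∞ :=
  ∫⁻ θ, ENNReal.ofReal (q θ * (M * deriv (fun t => Real.log (q t / p t)) θ ^ 2))

/-- The Kullback-Leibler divergence from `N(μ, σ²)` to the log-transformed inverse gamma target,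
as a function of the variational parameter `x = (μ, σ²)`. -/
def klObjective (a b : ℝ) (x : ℝ × ℝ) : ℝ≥0∞ :=
  InformationTheory.klDiv (gaussianReal x.1 x.2.toNNReal) (logInvGamma a b)

/-- The Fisher divergence (weight `1`), as a function of `x = (μ, σ²)`. -/
def fdObjective (a b : ℝ) (x : ℝ × ℝ) : ℝ≥0∞ :=
  weightedFisherDiv 1 (gaussianPDFReal x.1 x.2.toNNReal) (logInvGammaPDF a b)

/-- The score-based divergence (the weight is the variance of the Gaussian approximation),
as a function of `x = (μ, σ²)`. -/
def sdObjective (a b : ℝ) (x : ℝ × ℝ) : ℝ≥0∞ :=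
  weightedFisherDiv x.2.toNNReal (gaussianPDFReal x.1 x.2.toNNReal) (logInvGammaPDF a b)

/-- The admissible parameters `(μ, σ²)` of a nondegenerate univariate Gaussian. -/
def gaussianParams : Set (ℝ × ℝ) := {x | 0 < x.2}

/-- `x = (μ, σ²)` is a global minimizer of the objective over all Gaussians. -/
def IsOptimal (D : ℝ × ℝ → ℝ≥0∞) (x : ℝ × ℝ) : Prop :=
  x ∈ gaussianParams ∧ IsMinOn D gaussianParams x

/-- `x = (μ, σ²)` is a local minimizer of the objective over all Gaussians. -/
def IsLocallyOptimal (D : ℝ × ℝ → ℝ≥0∞) (x : ℝ × ℝ) : Prop :=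
  x ∈ gaussianParams ∧ IsLocalMinOn D gaussianParams x

/-- The principal branch of the real Lambert W function: the inverse of `w ↦ w * exp w` on
`[-1, ∞)`; it is meaningful on `[-exp (-1), ∞)`. -/
def lambertW0 (x : ℝ) : ℝ :=
  Function.invFunOn (fun w : ℝ => w * Real.exp w) (Set.Ici (-1)) x

/-- Closed-form variance parameter for the Kullback-Leibler divergence. -/
def varKL (a : ℝ) : ℝ := 1 / a

/-- Closed-form mean parameter for the Kullback-Leibler divergence. -/
def meanKL (a b : ℝ) : ℝ := Real.log (b / a) + 1 / (2 * a)

/-- Closed-form variance parameter for the Fisher divergence. -/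
def varFD (a : ℝ) : ℝ := -2 * lambertW0 (-(1 / (2 * (a + 1))))

/-- Closed-form mean parameter for the Fisher divergence. -/
def meanFD (a b : ℝ) : ℝ := Real.log (b / (a + 1)) + 3 * varFD a / 2

/-- Closed-form variance parameter for the score-based divergence. -/
def varSD (a : ℝ) : ℝ := 1 - lambertW0 (Real.exp 1 * a ^ 2 / (a + 1) ^ 2)

/-- Closed-form mean parameter for the score-based divergence. -/
def meanSD (a b : ℝ) : ℝ := Real.log (b / (a + 1)) + 3 * varSD a / 2

end

/-! ### The Lambert W function and the closed-form variances -/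

lemma lambertW0_spec {x : ℝ} (hx : -Real.exp (-1) ≤ x) :
    -1 ≤ lambertW0 x ∧ lambertW0 x * Real.exp (lambertW0 x) = x := by
  have hex : ∃ w ∈ Set.Ici (-1 : ℝ), w * Real.exp w = x := by
    have h1 : (-1 : ℝ) ≤ |x| := by linarith [abs_nonneg x]
    have hc : ContinuousOn (fun w : ℝ => w * Real.exp w) (Set.Icc (-1) |x|) := by fun_prop
    have hmem : x ∈ Set.Icc ((-1 : ℝ) * Real.exp (-1)) (|x| * Real.exp |x|) := by
      refine ⟨by linarith, (le_abs_self x).trans ?_⟩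
      exact le_mul_of_one_le_right (abs_nonneg x) (Real.one_le_exp (abs_nonneg x))
    obtain ⟨w, hw, hwx⟩ := intermediate_value_Icc h1 hc hmem
    exact ⟨w, hw.1, hwx⟩
  exact ⟨Function.invFunOn_mem hex, Function.invFunOn_eq hex⟩

lemma varFD_spec {a : ℝ} (ha : 1 / 2 < a) :
    0 < varFD a ∧ varFD a < 2 ∧ (a + 1) * (varFD a * Real.exp (-(varFD a) / 2)) = 1 := by
  have he : Real.exp 1 < 3 := by linarith [Real.exp_one_lt_d9]
  have hlt : -Real.exp (-1) < -(1 / (2 * (a + 1))) := by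
    rw [Real.exp_neg, neg_lt_neg_iff, ← one_div]
    exact one_div_lt_one_div_of_lt (Real.exp_pos 1) (by linarith)
  obtain ⟨h1, h2⟩ := lambertW0_spec hlt.le
  set W := lambertW0 (-(1 / (2 * (a + 1)))) with hW
  have hv : varFD a = -2 * W := by rw [varFD]
  have hWneg : W < 0 := by
    by_contra! hcon
    have : 0 ≤ W * Real.exp W := by positivity
    have : 0 < 1 / (2 * (a + 1)) := by positivity
    linarith
  have hWne : W ≠ -1 := by
    intro h
    rw [h] at h2
    linarith
  have hW1 : -1 < W := lt_of_le_of_ne h1 (Ne.symm hWne)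
  refine ⟨by rw [hv]; linarith, by rw [hv]; linarith, ?_⟩
  rw [hv, show -(-2 * W) / 2 = W by ring, show (a + 1) * (-2 * W * Real.exp W) =
    -2 * (a + 1) * (W * Real.exp W) by ring, h2]
  field_simp

lemma varSD_spec {a : ℝ} (ha : 1 / 2 < a) :
    0 < varSD a ∧ varSD a < 1 ∧ (a + 1) ^ 2 * ((1 - varSD a) * Real.exp (-varSD a)) = a ^ 2 := by
  have hpos : 0 < Real.exp 1 * a ^ 2 / (a + 1) ^ 2 := by positivity
  have hlt : Real.exp 1 * a ^ 2 / (a + 1) ^ 2 < Real.exp 1 := by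
    rw [div_lt_iff₀ (by positivity)]
    exact mul_lt_mul_of_pos_left (by nlinarith) (Real.exp_pos 1)
  obtain ⟨h1, h2⟩ := lambertW0_spec (x := Real.exp 1 * a ^ 2 / (a + 1) ^ 2)
    (by linarith [Real.exp_pos (-1)])
  set W := lambertW0 (Real.exp 1 * a ^ 2 / (a + 1) ^ 2) with hW
  have hv : varSD a = 1 - W := by rw [varSD]
  have hW0 : 0 < W := by
    by_contra! hcon
    have : W * Real.exp W ≤ 0 := mul_nonpos_of_nonpos_of_nonneg hcon (Real.exp_pos W).le
    linarith
  have hW1 : W < 1 := by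
    by_contra! hcon
    have h3 : Real.exp 1 ≤ Real.exp W := Real.exp_le_exp.2 hcon
    have : Real.exp 1 ≤ W * Real.exp W := h3.trans (le_mul_of_one_le_left (Real.exp_pos W).le hcon)
    linarith
  refine ⟨by rw [hv]; linarith, by rw [hv]; linarith, ?_⟩
  rw [hv, show 1 - (1 - W) = W by ring, show -(1 - W) = W - 1 by ring, Real.exp_sub,
    show (a + 1) ^ 2 * (W * (Real.exp W / Real.exp 1)) =
    (a + 1) ^ 2 * (W * Real.exp W) / Real.exp 1 by ring, h2]
  field_simp

/-! ### Monotonicity -/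

lemma hasDerivAt_mul_exp_neg_half (v : ℝ) :
    HasDerivAt (fun v : ℝ => v * Real.exp (-v / 2)) ((1 - v / 2) * Real.exp (-v / 2)) v := by
  have h := (hasDerivAt_id' v).fun_mul (((hasDerivAt_id' v).fun_neg.div_const 2).exp)
  convert! h using 1
  ring

lemma strictMonoOn_mul_exp_neg_half :
    StrictMonoOn (fun v : ℝ => v * Real.exp (-v / 2)) (Set.Icc 0 2) := by
  refine strictMonoOn_of_deriv_pos (convex_Icc 0 2) (by fun_prop) fun v hv => ?_
  rw [interior_Icc] at hv
  rw [(hasDerivAt_mul_exp_neg_half v).deriv]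
  exact mul_pos (by linarith [hv.2]) (Real.exp_pos _)

lemma strictAntiOn_mul_exp_neg_half :
    StrictAntiOn (fun v : ℝ => v * Real.exp (-v / 2)) (Set.Ici 2) := by
  refine strictAntiOn_of_deriv_neg (convex_Ici 2) (by fun_prop) fun v hv => ?_
  rw [interior_Ici] at hv
  rw [(hasDerivAt_mul_exp_neg_half v).deriv]
  exact mul_neg_of_neg_of_pos (by linarith [Set.mem_Ioi.1 hv]) (Real.exp_pos _)

lemma strictAntiOn_one_sub_mul_exp_neg :
    StrictAntiOn (fun v : ℝ => (1 - v) * Real.exp (-v)) (Set.Iic 2) := by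
  refine strictAntiOn_of_deriv_neg (convex_Iic 2) (by fun_prop) fun v hv => ?_
  rw [interior_Iic] at hv
  have h := ((hasDerivAt_id' v).const_sub 1).fun_mul ((hasDerivAt_id' v).fun_neg.exp)
  have h' : HasDerivAt (fun v : ℝ => (1 - v) * Real.exp (-v)) ((v - 2) * Real.exp (-v)) v := by
    convert! h using 1
    ring
  rw [h'.deriv]
  exact mul_neg_of_neg_of_pos (by linarith [Set.mem_Iio.1 hv]) (Real.exp_pos _)

lemma varFD_lt_of_one_lt {a w : ℝ} (ha : 1 / 2 < a) (hw0 : 0 ≤ w) (hw2 : w ≤ 2)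
    (h : 1 < (a + 1) * (w * Real.exp (-w / 2))) : varFD a < w := by
  obtain ⟨h1, h2, h3⟩ := varFD_spec ha
  refine (strictMonoOn_mul_exp_neg_half.lt_iff_lt ⟨h1.le, h2.le⟩ ⟨hw0, hw2⟩).1 ?_
  exact lt_of_mul_lt_mul_left (h3.trans_lt h) (by linarith)

lemma lt_varFD_of_lt_one {a w : ℝ} (ha : 1 / 2 < a) (hw0 : 0 ≤ w) (hw2 : w ≤ 2)
    (h : (a + 1) * (w * Real.exp (-w / 2)) < 1) : w < varFD a := by
  obtain ⟨h1, h2, h3⟩ := varFD_spec ha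
  refine (strictMonoOn_mul_exp_neg_half.lt_iff_lt ⟨hw0, hw2⟩ ⟨h1.le, h2.le⟩).1 ?_
  exact lt_of_mul_lt_mul_left (h.trans_eq h3.symm) (by linarith)

lemma varFD_le_one_iff {a : ℝ} (ha : 1 / 2 < a) :
    varFD a ≤ 1 ↔ Real.sqrt (Real.exp 1) - 1 ≤ a := by
  obtain ⟨h1, h2, h3⟩ := varFD_spec ha
  have hsq : Real.sqrt (Real.exp 1) = Real.exp (1 / 2) := by
    rw [Real.sqrt_eq_iff_mul_self_eq (Real.exp_pos _).le (Real.exp_pos _).le, ← Real.exp_add]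
    norm_num
  rw [← strictMonoOn_mul_exp_neg_half.le_iff_le ⟨h1.le, h2.le⟩ (by norm_num : (1 : ℝ) ∈ Set.Icc 0 2),
    ← mul_le_mul_iff_right₀ (show 0 < a + 1 by linarith), h3, hsq, sub_le_iff_le_add]
  rw [show (-1 : ℝ) / 2 = -(1 / 2) by norm_num, Real.exp_neg, one_mul, ← div_eq_mul_inv,
    one_le_div (Real.exp_pos _)]

/-! ### Orderings of the closed-form parameters -/

lemma varSD_lt_varFD {a : ℝ} (ha : 1 / 2 < a) : varSD a < varFD a := by
  obtain ⟨h1, h2, h3⟩ := varSD_spec ha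
  set v := varSD a
  refine lt_varFD_of_lt_one ha h1.le (by linarith) ?_
  set s := Real.sqrt (1 - v)
  have hs0 : 0 ≤ s := Real.sqrt_nonneg _
  have hs : s ^ 2 = 1 - v := Real.sq_sqrt (by linarith)
  have hs1 : s ≤ 1 - v / 2 := by nlinarith
  set E := Real.exp (-v / 2)
  have hE : 0 < E := Real.exp_pos _
  have hE2 : Real.exp (-v) = E ^ 2 := by
    rw [← Real.exp_nat_mul]; congr 1; push_cast; ring
  have hEinv : E * (1 + v / 2) < 1 := by
    have h4 : 1 + v / 2 < Real.exp (v / 2) := by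
      linarith [Real.add_one_lt_exp (show v / 2 ≠ 0 by positivity)]
    calc E * (1 + v / 2) < E * Real.exp (v / 2) := mul_lt_mul_of_pos_left h4 hE
      _ = 1 := by rw [← Real.exp_add, show -v / 2 + v / 2 = 0 by ring, Real.exp_zero]
  have hroot : (a + 1) * (s * E) = a := by
    rw [hE2, ← hs] at h3
    have : ((a + 1) * (s * E)) ^ 2 = a ^ 2 := by rw [← h3]; ring
    exact (pow_left_inj₀ (by positivity) (by linarith) two_ne_zero).1 this
  have hsum : E * (v + s) < 1 :=
    (mul_le_mul_of_nonneg_left (by linarith : v + s ≤ 1 + v / 2) hE.le).trans_lt hEinv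
  have := mul_lt_mul_of_pos_left hsum (show 0 < a + 1 by linarith)
  linarith

lemma half_lt_log_one_add {x : ℝ} (hx0 : 0 < x) (hx2 : x < 2) : x / 2 < Real.log (1 + x) := by
  refine lt_trans ?_ (Real.lt_log_one_add_of_pos hx0)
  rw [div_lt_div_iff₀ (by norm_num) (by linarith)]
  nlinarith

lemma varFD_lt_varKL {a : ℝ} (ha : 1 / 2 < a) : varFD a < varKL a := by
  have ha0 : 0 < a := by linarith
  have hx2 : 1 / a < 2 := by rw [div_lt_iff₀ ha0]; linarith
  have hx0 : 0 < 1 / a := by positivity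
  refine varFD_lt_of_one_lt ha hx0.le hx2.le ?_
  have h := half_lt_log_one_add hx0 hx2
  rw [varKL, ← mul_assoc, mul_one_div, add_div, div_self ha0.ne',
    ← Real.exp_log (show 0 < 1 + 1 / a by positivity), ← Real.exp_add, Real.one_lt_exp_iff]
  linarith

lemma log_three_lt : Real.log 3 < 9 / 8 := by
  rw [Real.log_lt_iff_lt_exp (by norm_num)]
  have h1 : Real.exp (9 / 8) = Real.exp 1 * Real.exp (1 / 8) := by
    rw [← Real.exp_add]; norm_num
  have h2 : 1 / 8 + 1 ≤ Real.exp (1 / 8) := Real.add_one_le_exp _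
  have h3 := Real.exp_one_gt_d9
  rw [h1]
  nlinarith

lemma exp_neg_two_mul_lt {u : ℝ} (h0 : 0 < u) (h1 : u < 3 / 4) : Real.exp (-2 * u) < 1 - u := by
  have hend : Real.exp (-2 * (3 / 4)) < 1 / 4 := by
    rw [show (-2 : ℝ) * (3 / 4) = -(3 / 2) by norm_num, Real.exp_neg, ← one_div]
    refine one_div_lt_one_div_of_lt (by norm_num) ?_
    have h4 : Real.exp (3 / 2) = Real.exp 1 * Real.exp (1 / 2) := by
      rw [← Real.exp_add]; norm_num
    have h5 : 1 / 2 + 1 ≤ Real.exp (1 / 2) := Real.add_one_le_exp _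
    rw [h4]
    nlinarith [Real.exp_one_gt_d9]
  have hcv := convexOn_exp.2 (Set.mem_univ (-2 * (3 / 4))) (Set.mem_univ (0 : ℝ))
    (show (0 : ℝ) ≤ u / (3 / 4) by positivity)
    (show 0 ≤ 1 - u / (3 / 4) by rw [sub_nonneg, div_le_one (by norm_num)]; exact h1.le) (by ring)
  simp only [smul_eq_mul, mul_zero, add_zero, Real.exp_zero, mul_one] at hcv
  rw [show u / (3 / 4) * (-2 * (3 / 4)) = -2 * u by ring] at hcv
  nlinarith

lemma log_one_add_inv_lt_varSD {a : ℝ} (ha : 1 / 2 < a) :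
    2 / 3 * Real.log (1 + 1 / a) < varSD a := by
  have ha0 : 0 < a := by linarith
  obtain ⟨h1, h2, h3⟩ := varSD_spec ha
  have hx2 : 1 / a < 2 := by rw [div_lt_iff₀ ha0]; linarith
  have hx0 : 0 < 1 / a := by positivity
  have hL0 : 0 < Real.log (1 + 1 / a) := Real.log_pos (by linarith)
  have hL1 : Real.log (1 + 1 / a) < 9 / 8 :=
    (Real.log_lt_log (by linarith) (by linarith)).trans log_three_lt
  set u := 2 / 3 * Real.log (1 + 1 / a) with hu
  have hu0 : 0 < u := by positivity
  have hu1 : u < 3 / 4 := by linarith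
  refine (strictAntiOn_one_sub_mul_exp_neg.lt_iff_gt
    (Set.mem_Iic.2 (by linarith)) (Set.mem_Iic.2 (by linarith))).1 ?_
  have hexp : (1 + 1 / a) ^ 2 * Real.exp (-2 * u) * Real.exp (-u) = 1 := by
    rw [← Real.exp_log (show 0 < 1 + 1 / a by positivity), ← Real.exp_nat_mul, ← Real.exp_add,
      ← Real.exp_add, Real.exp_eq_one_iff]
    push_cast
    rw [hu]
    ring
  have hA : (a + 1) ^ 2 * Real.exp (-2 * u) * Real.exp (-u) = a ^ 2 := by
    calc _ = a ^ 2 * ((1 + 1 / a) ^ 2 * Real.exp (-2 * u) * Real.exp (-u)) := by field_simp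
      _ = a ^ 2 := by rw [hexp, mul_one]
  have h4 := mul_lt_mul_of_pos_right (exp_neg_two_mul_lt hu0 hu1) (Real.exp_pos (-u))
  have hpos : 0 < (a + 1) ^ 2 := by positivity
  refine lt_of_mul_lt_mul_left ?_ hpos.le
  have := mul_lt_mul_of_pos_left h4 hpos
  nlinarith

lemma pade_le_log_one_add {x : ℝ} (hx : 0 ≤ x) :
    3 * x * (2 + x) / (6 + 6 * x + x ^ 2) ≤ Real.log (1 + x) := by
  have hD : ∀ y : ℝ, 0 ≤ y → 0 < 6 + 6 * y + y ^ 2 := fun y hy => by positivity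
  have hder : ∀ y : ℝ, 0 ≤ y → HasDerivAt
      (fun y : ℝ => Real.log (1 + y) - 3 * y * (2 + y) / (6 + 6 * y + y ^ 2))
      (y ^ 4 / ((1 + y) * (6 + 6 * y + y ^ 2) ^ 2)) y := by
    intro y hy
    have e1 : HasDerivAt (fun y : ℝ => Real.log (1 + y)) (1 / (1 + y)) y :=
      ((hasDerivAt_id' y).const_add 1).log (by positivity)
    have e2 : HasDerivAt (fun y : ℝ => 3 * y * (2 + y)) (6 + 6 * y) y := by
      have := ((hasDerivAt_id' y).const_mul 3).fun_mul ((hasDerivAt_id' y).const_add 2)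
      convert! this using 1
      ring
    have e3 : HasDerivAt (fun y : ℝ => 6 + 6 * y + y ^ 2) (6 + 2 * y) y := by
      have := (((hasDerivAt_id' y).const_mul 6).const_add 6).fun_add ((hasDerivAt_id' y).fun_pow 2)
      convert! this using 1
      push_cast
      ring
    convert! e1.fun_sub (e2.fun_div e3 (hD y hy).ne') using 1
    have := (hD y hy).ne'
    field_simp
    ring
  have hmono : MonotoneOn
      (fun y : ℝ => Real.log (1 + y) - 3 * y * (2 + y) / (6 + 6 * y + y ^ 2)) (Set.Ici 0) := by
    refine monotoneOn_of_deriv_nonneg (convex_Ici 0)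
      (fun y hy => (hder y hy).continuousAt.continuousWithinAt)
      (fun y hy => ?_) (fun y hy => ?_)
    · rw [interior_Ici] at hy
      exact (hder y (le_of_lt hy)).differentiableAt.differentiableWithinAt
    · rw [interior_Ici] at hy
      have hy0 : 0 < y := hy
      rw [(hder y hy0.le).deriv]
      positivity
  have := hmono (Set.mem_Ici.2 le_rfl) (Set.mem_Ici.2 hx) hx
  simp only [add_zero, Real.log_one, mul_zero, zero_mul, zero_div, sub_zero] at this
  linarith

lemma sub_inv_half_le_log {r : ℝ} (hr0 : 0 < r) (hr1 : r ≤ 1) : (r - r⁻¹) / 2 ≤ Real.log r := by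
  have h := Real.self_le_sinh_iff.2 (neg_nonneg.2 (Real.log_nonpos hr0.le hr1))
  rw [Real.sinh_neg, Real.sinh_eq, Real.exp_neg, Real.exp_log hr0] at h
  linarith

lemma log_ratio_pos {x : ℝ} (hx0 : 0 < x) (hx2 : x < 2) :
    0 < Real.log (2 / 3 * (Real.log (1 + x) + x / 2) / x) + 2 / 3 * Real.log (1 + x) - x / 6 := by
  have hD : 0 < 6 + 6 * x + x ^ 2 := by positivity
  set D := 6 + 6 * x + x ^ 2 with hDdef
  set N := 18 + 12 * x + x ^ 2 with hNdef
  have hN : 0 < N := by positivity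
  have hL := pade_le_log_one_add hx0.le
  rw [← hDdef] at hL
  have hr : N / (3 * D) ≤ 2 / 3 * (Real.log (1 + x) + x / 2) / x := by
    rw [le_div_iff₀ hx0]
    have : N / (3 * D) * x = 2 / 3 * (3 * x * (2 + x) / D + x / 2) := by
      field_simp
      rw [hNdef, hDdef]
      ring
    linarith
  have hr0 : 0 < N / (3 * D) := by positivity
  have hr1 : N / (3 * D) ≤ 1 := by
    rw [div_le_one (by positivity)]
    rw [hNdef, hDdef]
    nlinarith
  have h1 := (sub_inv_half_le_log hr0 hr1).trans (Real.log_le_log hr0 hr)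
  have hkey : 0 < (N / (3 * D) - (N / (3 * D))⁻¹) / 2 + 2 / 3 * (3 * x * (2 + x) / D) - x / 6 := by
    have : (N / (3 * D) - (N / (3 * D))⁻¹) / 2 + 2 / 3 * (3 * x * (2 + x) / D) - x / 6 =
        x * (108 + 72 * x - 12 * x ^ 2 - 14 * x ^ 3 - x ^ 4) / (6 * N * D) := by
      field_simp
      rw [hNdef, hDdef]
      ring
    rw [this]
    have h2 : 0 < 108 + 72 * x - 12 * x ^ 2 - 14 * x ^ 3 - x ^ 4 := by
      have e2 : x ^ 2 ≤ 4 := by nlinarith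
      have e3 : x ^ 3 ≤ 4 * x := by nlinarith
      have e4 : x ^ 4 ≤ 16 := by nlinarith
      linarith
    positivity
  linarith

lemma three_halves_varFD_lt {a : ℝ} (ha : 1 / 2 < a) :
    3 / 2 * varFD a < Real.log (1 + 1 / a) + 1 / (2 * a) := by
  have ha0 : 0 < a := by linarith
  have hx2 : 1 / a < 2 := by rw [div_lt_iff₀ ha0]; linarith
  have hx0 : 0 < 1 / a := by positivity
  have hkey := log_ratio_pos hx0 hx2
  have hL0 : 0 < Real.log (1 + 1 / a) := Real.log_pos (by linarith)
  have hL1 : Real.log (1 + 1 / a) < 9 / 8 :=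
    (Real.log_lt_log (by linarith) (by linarith)).trans log_three_lt
  have hahalf : 1 / (2 * a) = 1 / a / 2 := by field_simp
  have hax : a + 1 = (1 + 1 / a) / (1 / a) := by field_simp
  rw [hahalf]
  set x := 1 / a with hx
  set w := 2 / 3 * (Real.log (1 + x) + x / 2) with hw
  have hw0 : 0 < w := by positivity
  have hlt : varFD a < w := by
    refine varFD_lt_of_one_lt ha hw0.le (by rw [hw]; linarith) ?_
    rw [hax, show (1 + x) / x * (w * Real.exp (-w / 2)) = (w / x) * (1 + x) * Real.exp (-w / 2) by
      field_simp, ← Real.log_pos_iff (by positivity), Real.log_mul (by positivity) (by positivity),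
      Real.log_mul (by positivity) (by positivity), Real.log_exp]
    have : -w / 2 = -(1 / 3) * Real.log (1 + x) - x / 6 := by rw [hw]; ring
    linarith
  rw [hw] at hlt
  linarith

lemma meanSD_lt_meanFD {a b : ℝ} (ha : 1 / 2 < a) : meanSD a b < meanFD a b := by
  have := varSD_lt_varFD ha
  rw [meanSD, meanFD]
  linarith

lemma log_div_eq_add {a b : ℝ} (ha : 0 < a) (hb : 0 < b) :
    Real.log (b / a) = Real.log (b / (a + 1)) + Real.log (1 + 1 / a) := by
  rw [← Real.log_mul (by positivity) (by positivity)]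
  congr 1
  field_simp

lemma meanFD_lt_meanKL {a b : ℝ} (ha : 1 / 2 < a) (hb : 0 < b) : meanFD a b < meanKL a b := by
  have := three_halves_varFD_lt ha
  rw [meanFD, meanKL, log_div_eq_add (show 0 < a by linarith) hb]
  linarith

lemma log_div_lt_meanSD {a b : ℝ} (ha : 1 / 2 < a) (hb : 0 < b) :
    Real.log (b / a) < meanSD a b := by
  have := log_one_add_inv_lt_varSD ha
  rw [meanSD, log_div_eq_add (show 0 < a by linarith) hb]
  linarith

/-! ### The log-transformed inverse gamma distribution -/

lemma logInvGammaPDF_pos {a b : ℝ} (ha : 0 < a) (hb : 0 < b) (θ : ℝ) : 0 < logInvGammaPDF a b θ :=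
  mul_pos (div_pos (Real.rpow_pos_of_pos hb a) (Real.Gamma_pos_of_pos ha)) (Real.exp_pos _)

lemma continuous_logInvGammaPDF (a b : ℝ) : Continuous (logInvGammaPDF a b) := by
  unfold logInvGammaPDF
  fun_prop

lemma measurable_ofReal_logInvGammaPDF (a b : ℝ) :
    Measurable fun θ => ENNReal.ofReal (logInvGammaPDF a b θ) :=
  (continuous_logInvGammaPDF a b).measurable.ennreal_ofReal

lemma exp_neg_mul_gammaPDFReal_exp_neg (a b θ : ℝ) :
    Real.exp (-θ) * gammaPDFReal a b (Real.exp (-θ)) = logInvGammaPDF a b θ := by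
  rw [gammaPDFReal, if_pos (Real.exp_pos _).le, logInvGammaPDF, ← Real.exp_mul]
  have : Real.exp (-a * θ - b * Real.exp (-θ)) =
      Real.exp (-θ) * Real.exp (-θ * (a - 1)) * Real.exp (-(b * Real.exp (-θ))) := by
    rw [← Real.exp_add, ← Real.exp_add]
    congr 1
    ring
  rw [this]
  ring

lemma map_log_inv_gammaMeasure (a b : ℝ) :
    (gammaMeasure a b).map (fun y => Real.log y⁻¹) = logInvGamma a b := by
  have hmeas : Measurable fun y : ℝ => Real.log y⁻¹ := Real.measurable_log.comp measurable_inv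
  ext s hs
  rw [Measure.map_apply hmeas hs, gammaMeasure, withDensity_apply _ (hmeas hs), logInvGamma,
    withDensity_apply _ hs]
  have hae : ∀ᵐ y : ℝ, gammaPDF a b y = (Set.Ioi 0).indicator (gammaPDF a b) y := by
    have h0 : ∀ᵐ y : ℝ, y ≠ 0 := by simp [ae_iff]
    filter_upwards [h0] with y hy
    rcases lt_or_gt_of_ne hy with h | h
    · rw [gammaPDF_of_neg h, Set.indicator_of_notMem (by simpa using h.le)]
    · rw [Set.indicator_of_mem (Set.mem_Ioi.2 h)]
  have himage : Set.Ioi 0 ∩ (fun y : ℝ => Real.log y⁻¹) ⁻¹' s = (fun θ => Real.exp (-θ)) '' s := by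
    ext y
    constructor
    · rintro ⟨hy0, hy⟩
      refine ⟨_, hy, ?_⟩
      simp only [Real.log_inv, neg_neg]
      exact Real.exp_log hy0
    · rintro ⟨θ, hθ, rfl⟩
      exact ⟨Real.exp_pos _, by simpa using hθ⟩
  rw [lintegral_congr_ae (ae_restrict_of_ae hae), setLIntegral_indicator measurableSet_Ioi, himage,
    lintegral_image_eq_lintegral_abs_deriv_mul (f' := fun θ => -Real.exp (-θ)) hs
      (fun θ _ => ((hasDerivAt_id' θ).fun_neg.exp.congr_deriv (mul_neg_one _)).hasDerivWithinAt)
      (fun x _ y _ hxy => by simpa using hxy)]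
  refine setLIntegral_congr_fun hs fun θ _ => ?_
  rw [abs_neg, abs_of_pos (Real.exp_pos _), gammaPDF, ← ENNReal.ofReal_mul (Real.exp_pos _).le,
    exp_neg_mul_gammaPDFReal_exp_neg]

lemma isProbabilityMeasure_logInvGamma {a b : ℝ} (ha : 0 < a) (hb : 0 < b) :
    IsProbabilityMeasure (logInvGamma a b) := by
  rw [← map_log_inv_gammaMeasure]
  have := isProbabilityMeasure_gammaMeasure ha hb
  exact Measure.isProbabilityMeasure_map (Real.measurable_log.comp measurable_inv).aemeasurable

lemma lintegral_logInvGammaPDF {a b : ℝ} (ha : 0 < a) (hb : 0 < b) :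
    ∫⁻ θ, ENNReal.ofReal (logInvGammaPDF a b θ) = 1 := by
  have h := (isProbabilityMeasure_logInvGamma ha hb).measure_univ
  rwa [logInvGamma, withDensity_apply _ MeasurableSet.univ, Measure.restrict_univ] at h

lemma integrable_logInvGammaPDF {a b : ℝ} (ha : 0 < a) (hb : 0 < b) :
    Integrable (logInvGammaPDF a b) := by
  refine ⟨(continuous_logInvGammaPDF a b).aestronglyMeasurable, ?_⟩
  rw [hasFiniteIntegral_iff_ofReal (ae_of_all _ fun θ => (logInvGammaPDF_pos ha hb θ).le),
    lintegral_logInvGammaPDF ha hb]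
  exact ENNReal.one_lt_top

lemma integral_logInvGammaPDF {a b : ℝ} (ha : 0 < a) (hb : 0 < b) :
    ∫ θ, logInvGammaPDF a b θ = 1 := by
  rw [integral_eq_lintegral_of_nonneg_ae (ae_of_all _ fun θ => (logInvGammaPDF_pos ha hb θ).le)
    (continuous_logInvGammaPDF a b).aestronglyMeasurable, lintegral_logInvGammaPDF ha hb,
    ENNReal.toReal_one]

lemma exp_mul_logInvGammaPDF {a b t : ℝ} (hb : 0 < b) (ht : t < a) (θ : ℝ) :
    logInvGammaPDF a b θ * Real.exp (t * θ) =
      b ^ t * Real.Gamma (a - t) / Real.Gamma a * logInvGammaPDF (a - t) b θ := by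
  have h1 : Real.Gamma (a - t) ≠ 0 := (Real.Gamma_pos_of_pos (by linarith)).ne'
  have h2 : b ^ a = b ^ t * b ^ (a - t) := by rw [← Real.rpow_add hb]; congr 1; ring
  have h3 : Real.exp (-(a - t) * θ - b * Real.exp (-θ)) =
      Real.exp (-a * θ - b * Real.exp (-θ)) * Real.exp (t * θ) := by
    rw [← Real.exp_add]; congr 1; ring
  rw [logInvGammaPDF, logInvGammaPDF, h3, h2]
  field_simp

lemma integrable_exp_mul_logInvGamma {a b t : ℝ} (ha : 0 < a) (hb : 0 < b) (ht : t < a) :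
    Integrable (fun θ => Real.exp (t * θ)) (logInvGamma a b) := by
  rw [logInvGamma, integrable_withDensity_iff_integrable_smul'
    (measurable_ofReal_logInvGammaPDF a b) (ae_of_all _ fun _ => ENNReal.ofReal_lt_top)]
  refine ((integrable_logInvGammaPDF (sub_pos.2 ht) hb).const_mul
    (b ^ t * Real.Gamma (a - t) / Real.Gamma a)).congr (ae_of_all _ fun θ => ?_)
  dsimp only
  rw [ENNReal.toReal_ofReal (logInvGammaPDF_pos ha hb θ).le, smul_eq_mul,
    exp_mul_logInvGammaPDF hb ht]

lemma mgf_logInvGamma {a b t : ℝ} (ha : 0 < a) (hb : 0 < b) (ht : t < a) :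
    mgf (fun θ : ℝ => θ) (logInvGamma a b) t = b ^ t * Real.Gamma (a - t) / Real.Gamma a := by
  rw [mgf, logInvGamma, integral_withDensity_eq_integral_toReal_smul
    (measurable_ofReal_logInvGammaPDF a b) (ae_of_all _ fun _ => ENNReal.ofReal_lt_top)]
  have : ∀ θ, (ENNReal.ofReal (logInvGammaPDF a b θ)).toReal • Real.exp (t * θ) =
      b ^ t * Real.Gamma (a - t) / Real.Gamma a * logInvGammaPDF (a - t) b θ := fun θ => by
    rw [ENNReal.toReal_ofReal (logInvGammaPDF_pos ha hb θ).le, smul_eq_mul,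
      exp_mul_logInvGammaPDF hb ht]
  simp_rw [this]
  rw [integral_const_mul, integral_logInvGammaPDF (sub_pos.2 ht) hb, mul_one]

lemma mem_interior_integrableExpSet_logInvGamma {a b t : ℝ} (ha : 0 < a) (hb : 0 < b)
    (ht : t < a) : t ∈ interior (integrableExpSet (fun θ : ℝ => θ) (logInvGamma a b)) :=
  interior_mono (s := Set.Iio a) (fun _ hs => integrable_exp_mul_logInvGamma ha hb hs)
    (by rwa [interior_Iio])

lemma memLp_logInvGamma {a b : ℝ} (ha : 0 < a) (hb : 0 < b) :
    MemLp (fun θ : ℝ => θ) 2 (logInvGamma a b) := by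
  exact_mod_cast memLp_of_mem_interior_integrableExpSet
    (mem_interior_integrableExpSet_logInvGamma ha hb ha) 2

lemma isMode_logInvGammaPDF_iff {a b : ℝ} (ha : 0 < a) (hb : 0 < b) (m : ℝ) :
    IsMode (logInvGammaPDF a b) m ↔ m = Real.log (b / a) := by
  have hC : 0 < b ^ a / Real.Gamma a := div_pos (Real.rpow_pos_of_pos hb a) (Real.Gamma_pos_of_pos ha)
  have hexp : ∀ θ : ℝ, b * Real.exp (-θ) = a * Real.exp (Real.log (b / a) - θ) := fun θ => by
    rw [sub_eq_add_neg, Real.exp_add, Real.exp_log (by positivity)]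
    field_simp
  have key : ∀ θ, θ ≠ Real.log (b / a) →
      logInvGammaPDF a b θ < logInvGammaPDF a b (Real.log (b / a)) := fun θ hθ => by
    refine mul_lt_mul_of_pos_left (Real.exp_lt_exp.2 ?_) hC
    rw [hexp, hexp, sub_self, Real.exp_zero]
    have := mul_lt_mul_of_pos_left (Real.add_one_lt_exp (sub_ne_zero.2 hθ.symm)) ha
    linarith
  constructor
  · intro h
    by_contra hne
    exact absurd (h (Set.mem_univ (Real.log (b / a)))) (not_le.2 (key m hne))
  · rintro rfl θ _
    rcases eq_or_ne θ (Real.log (b / a)) with h | h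
    · exact (congrArg (logInvGammaPDF a b) h).le
    · exact (key θ h).le

/-! ### Derivative of the logarithm of the Gamma function -/

lemma differentiableAt_log_Gamma {s : ℝ} (hs : 0 < s) :
    DifferentiableAt ℝ (Real.log ∘ Real.Gamma) s :=
  ((Real.differentiableOn_Gamma_Ioi.differentiableAt (Ioi_mem_nhds hs))).log
    (Real.Gamma_pos_of_pos hs).ne'

lemma log_Gamma_add_one {s : ℝ} (hs : 0 < s) :
    Real.log (Real.Gamma (s + 1)) = Real.log s + Real.log (Real.Gamma s) := by
  rw [Real.Gamma_add_one hs.ne', Real.log_mul hs.ne' (Real.Gamma_pos_of_pos hs).ne']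

lemma deriv_log_Gamma_add_one {s : ℝ} (hs : 0 < s) :
    deriv (Real.log ∘ Real.Gamma) (s + 1) = deriv (Real.log ∘ Real.Gamma) s + 1 / s := by
  have h1 : HasDerivAt (fun x => Real.log x + (Real.log ∘ Real.Gamma) x)
      (s⁻¹ + deriv (Real.log ∘ Real.Gamma) s) s :=
    (Real.hasDerivAt_log hs.ne').fun_add (differentiableAt_log_Gamma hs).hasDerivAt
  have h2 : HasDerivAt (fun x => (Real.log ∘ Real.Gamma) (x + 1))
      (deriv (Real.log ∘ Real.Gamma) (s + 1)) s :=
    (differentiableAt_log_Gamma (by linarith : 0 < s + 1)).hasDerivAt.comp_add_const s 1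
  have h3 : (fun x => (Real.log ∘ Real.Gamma) (x + 1)) =ᶠ[nhds s]
      fun x => Real.log x + (Real.log ∘ Real.Gamma) x := by
    filter_upwards [Ioi_mem_nhds hs] with x hx using log_Gamma_add_one hx
  rw [h2.unique (h1.congr_of_eventuallyEq h3), add_comm, one_div]

lemma deriv_log_Gamma_le_log {s : ℝ} (hs : 0 < s) :
    deriv (Real.log ∘ Real.Gamma) s ≤ Real.log s := by
  have h := Real.convexOn_log_Gamma.deriv_le_slope (Set.mem_Ioi.2 hs)
    (Set.mem_Ioi.2 (by linarith : 0 < s + 1)) (by linarith) (differentiableAt_log_Gamma hs)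
  rw [slope_def_field, Function.comp_apply, Function.comp_apply, log_Gamma_add_one hs] at h
  simpa using h

lemma log_one_add_inv_lt {s : ℝ} (hs : 0 < s) :
    Real.log ((s + 1) / s) < 1 / (2 * s) + 1 / (2 * (s + 1)) := by
  have h1 : 1 < (s + 1) / s := by rw [lt_div_iff₀ hs]; linarith
  have h := Real.self_lt_sinh_iff.2 (Real.log_pos h1)
  rw [Real.sinh_eq, Real.exp_neg, Real.exp_log (by positivity)] at h
  refine h.trans_eq ?_
  field_simp
  ring

lemma deriv_log_Gamma_lt {s : ℝ} (hs : 0 < s) :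
    deriv (Real.log ∘ Real.Gamma) s < Real.log s - 1 / (2 * s) := by
  set g : ℝ → ℝ := fun x => Real.log x - 1 / (2 * x) - deriv (Real.log ∘ Real.Gamma) x with hg
  have hstep : ∀ x, 0 < x → g (x + 1) < g x := fun x hx => by
    have h := log_one_add_inv_lt hx
    rw [Real.log_div (by positivity) hx.ne'] at h
    have h2 : 1 / x = 1 / (2 * x) + 1 / (2 * x) := by field_simp; norm_num
    simp only [hg, deriv_log_Gamma_add_one hx]
    linarith
  have hlow : ∀ x, 0 < x → -(1 / (2 * x)) ≤ g x := fun x hx => by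
    have := deriv_log_Gamma_le_log hx
    simp only [hg]
    linarith
  have hanti : ∀ n : ℕ, g (s + 1 + n) ≤ g (s + 1) := by
    intro n
    induction n with
    | zero => simp
    | succ k ih =>
      refine le_trans ?_ ih
      rw [Nat.cast_succ, ← add_assoc]
      exact (hstep _ (by positivity)).le
  have hlim : Filter.Tendsto (fun n : ℕ => -(1 / (2 * (s + 1 + (n : ℝ))))) Filter.atTop (nhds 0) := by
    rw [← neg_zero]
    refine Filter.Tendsto.neg ?_
    simp only [one_div]
    refine Filter.Tendsto.inv_tendsto_atTop ?_
    exact (Filter.tendsto_atTop_add_const_left _ _ tendsto_natCast_atTop_atTop).const_mul_atTop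
      (by norm_num)
  have h0 : 0 ≤ g (s + 1) :=
    le_of_tendsto' hlim fun n => (hlow _ (by positivity)).trans (hanti n)
  have := h0.trans_lt (hstep s hs)
  simp only [hg] at this
  linarith

/-! ### Mean and variance of the target -/

lemma integral_id_logInvGamma {a b : ℝ} (ha : 0 < a) (hb : 0 < b) :
    ∫ θ, θ ∂(logInvGamma a b) = Real.log b - deriv (Real.log ∘ Real.Gamma) a := by
  have h1 := hasDerivAt_mgf (mem_interior_integrableExpSet_logInvGamma ha hb ha)
  simp only [zero_mul, Real.exp_zero, mul_one] at h1
  have hG : Real.Gamma a ≠ 0 := (Real.Gamma_pos_of_pos ha).ne'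
  have hdG : HasDerivAt Real.Gamma (deriv Real.Gamma a) (a - 0) := by
    rw [sub_zero]
    exact (Real.differentiableOn_Gamma_Ioi.differentiableAt (Ioi_mem_nhds ha)).hasDerivAt
  have h2 : HasDerivAt (fun t => b ^ t * Real.Gamma (a - t) / Real.Gamma a)
      (Real.log b - deriv Real.Gamma a / Real.Gamma a) 0 := by
    have e1 : HasDerivAt (fun t : ℝ => b ^ t) (Real.log b) 0 := by
      simpa using (hasDerivAt_id' (0 : ℝ)).const_rpow hb
    have e2 : HasDerivAt (fun t => Real.Gamma (a - t)) (-deriv Real.Gamma a) 0 :=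
      hdG.comp_const_sub a 0
    convert! (e1.fun_mul e2).div_const (Real.Gamma a) using 1
    rw [sub_zero, Real.rpow_zero]
    field_simp
    ring
  have h3 : mgf (fun θ : ℝ => θ) (logInvGamma a b) =ᶠ[nhds 0]
      fun t => b ^ t * Real.Gamma (a - t) / Real.Gamma a := by
    filter_upwards [Iio_mem_nhds ha] with t ht using mgf_logInvGamma ha hb ht
  rw [h1.unique (h2.congr_of_eventuallyEq h3)]
  congr 1
  rw [sub_zero] at hdG
  exact (hdG.log hG).deriv.symm

lemma meanKL_lt_integral {a b : ℝ} (ha : 0 < a) (hb : 0 < b) :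
    meanKL a b < ∫ θ, θ ∂(logInvGamma a b) := by
  rw [integral_id_logInvGamma ha hb, meanKL, Real.log_div hb.ne' ha.ne']
  linarith [deriv_log_Gamma_lt ha]

lemma mgf_logInvGamma_sub_one {a b t : ℝ} (ha : 0 < a) (hb : 0 < b) (ht : t < a) :
    mgf (fun θ : ℝ => θ) (logInvGamma a b) (t + -1) =
      (a - t) / b * mgf (fun θ : ℝ => θ) (logInvGamma a b) t := by
  rw [mgf_logInvGamma ha hb ht, mgf_logInvGamma ha hb (by linarith),
    show a - (t + -1) = (a - t) + 1 by ring, Real.Gamma_add_one (by linarith),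
    Real.rpow_add hb, Real.rpow_neg_one]
  field_simp

lemma integral_exp_neg_logInvGamma {a b : ℝ} (ha : 0 < a) (hb : 0 < b) :
    ∫ θ, Real.exp (-1 * θ) ∂(logInvGamma a b) = a / b := by
  have := isProbabilityMeasure_logInvGamma ha hb
  have h := mgf_logInvGamma_sub_one ha hb ha
  rw [mgf_zero] at h
  simpa [mgf] using h

lemma integral_exp_neg_two_mul_logInvGamma {a b : ℝ} (ha : 0 < a) (hb : 0 < b) :
    ∫ θ, Real.exp (-2 * θ) ∂(logInvGamma a b) = a * (a + 1) / b ^ 2 := by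
  have h := mgf_logInvGamma_sub_one (t := -1) ha hb (by linarith)
  rw [show (-1 : ℝ) + -1 = -2 by norm_num, mgf, mgf, integral_exp_neg_logInvGamma ha hb] at h
  rw [h]
  field_simp
  ring

lemma integral_mul_exp_neg_logInvGamma {a b : ℝ} (ha : 0 < a) (hb : 0 < b) :
    ∫ θ, θ * Real.exp (-1 * θ) ∂(logInvGamma a b) = (a * (∫ θ, θ ∂(logInvGamma a b)) - 1) / b := by
  have := isProbabilityMeasure_logInvGamma ha hb
  have h0 := hasDerivAt_mgf (mem_interior_integrableExpSet_logInvGamma ha hb ha)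
  simp only [zero_mul, Real.exp_zero, mul_one] at h0
  have h1 := hasDerivAt_mgf (t := 0 + -1)
    (mem_interior_integrableExpSet_logInvGamma (t := 0 + -1) ha hb (by linarith))
  have h2 := h1.comp_add_const 0 (-1)
  have h3 : HasDerivAt (fun t => (a - t) / b * mgf (fun θ : ℝ => θ) (logInvGamma a b) t)
      ((a * (∫ θ, θ ∂(logInvGamma a b)) - 1) / b) 0 := by
    convert! (((hasDerivAt_id' (0 : ℝ)).const_sub a).div_const b).fun_mul h0 using 1
    rw [mgf_zero]
    ring
  have h4 : (fun t => mgf (fun θ : ℝ => θ) (logInvGamma a b) (t + -1)) =ᶠ[nhds 0]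
      fun t => (a - t) / b * mgf (fun θ : ℝ => θ) (logInvGamma a b) t := by
    filter_upwards [Iio_mem_nhds ha] with t ht using mgf_logInvGamma_sub_one ha hb ht
  have h5 := h2.unique (h3.congr_of_eventuallyEq h4)
  rwa [zero_add] at h5

lemma volume_absolutelyContinuous_logInvGamma {a b : ℝ} (ha : 0 < a) (hb : 0 < b) :
    (volume : Measure ℝ) ≪ logInvGamma a b :=
  withDensity_absolutelyContinuous' (measurable_ofReal_logInvGammaPDF a b).aemeasurable
    (ae_of_all _ fun θ => by simpa using logInvGammaPDF_pos ha hb θ)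

lemma varKL_lt_variance {a b : ℝ} (ha : 0 < a) (hb : 0 < b) :
    varKL a < variance (fun θ : ℝ => θ) (logInvGamma a b) := by
  have := isProbabilityMeasure_logInvGamma ha hb
  set ν := logInvGamma a b
  set m := ∫ θ, θ ∂ν with hm
  have i1 : Integrable (fun θ : ℝ => (θ - m) ^ 2) ν :=
    ((memLp_logInvGamma ha hb).sub (memLp_const m)).integrable_sq
  have i2 : Integrable (fun θ : ℝ => Real.exp (-1 * θ)) ν :=
    integrable_exp_mul_logInvGamma ha hb (by linarith)
  have i3 : Integrable (fun θ : ℝ => Real.exp (-2 * θ)) ν :=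
    integrable_exp_mul_logInvGamma ha hb (by linarith)
  have i4 : Integrable (fun θ : ℝ => θ * Real.exp (-1 * θ)) ν := by
    simpa using integrable_pow_mul_exp_of_mem_interior_integrableExpSet
      (mem_interior_integrableExpSet_logInvGamma ha hb (by linarith : (-1 : ℝ) < a)) 1
  have i5 : Integrable (fun θ : ℝ => θ) ν := (memLp_logInvGamma ha hb).integrable (by norm_num)
  have hexpand : ∀ θ : ℝ, (θ - m + (b / a * Real.exp (-1 * θ) - 1)) ^ 2 =
      (θ - m) ^ 2 + 2 * (b / a) * (θ * Real.exp (-1 * θ)) +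
      (-2 * (b / a) * (m + 1)) * Real.exp (-1 * θ) + (b / a) ^ 2 * Real.exp (-2 * θ) +
      (-2) * θ + (2 * m + 1) := fun θ => by
    have : Real.exp (-2 * θ) = Real.exp (-1 * θ) ^ 2 := by
      rw [← Real.exp_nat_mul]; congr 1; push_cast; ring
    rw [this]
    ring
  have s1 := i1.fun_add (i4.const_mul (2 * (b / a)))
  have s2 := s1.fun_add (i2.const_mul (-2 * (b / a) * (m + 1)))
  have s3 := s2.fun_add (i3.const_mul ((b / a) ^ 2))
  have s4 := s3.fun_add (i5.const_mul (-2))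
  have hint : Integrable (fun θ : ℝ => (θ - m + (b / a * Real.exp (-1 * θ) - 1)) ^ 2) ν := by
    simp_rw [hexpand]
    exact s4.add (integrable_const _)
  have hvar : variance (fun θ : ℝ => θ) ν = ∫ θ, (θ - m) ^ 2 ∂ν :=
    variance_eq_integral (memLp_logInvGamma ha hb).aemeasurable
  have hval : ∫ θ, (θ - m + (b / a * Real.exp (-1 * θ) - 1)) ^ 2 ∂ν =
      variance (fun θ : ℝ => θ) ν - 1 / a := by
    simp_rw [hexpand]
    rw [integral_add s4 (integrable_const _), integral_add s3 (i5.const_mul _),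
      integral_add s2 (i3.const_mul _), integral_add s1 (i2.const_mul _),
      integral_add i1 (i4.const_mul _)]
    have hlin : ∫ θ : ℝ, -2 * θ ∂ν = -2 * m := integral_const_mul _ _
    rw [hlin]
    simp only [integral_const_mul, integral_const, probReal_univ, one_smul]
    rw [integral_mul_exp_neg_logInvGamma ha hb, integral_exp_neg_logInvGamma ha hb,
      integral_exp_neg_two_mul_logInvGamma ha hb, hvar, ← hm]
    generalize ∫ θ, (θ - m) ^ 2 ∂ν = V
    field_simp
    ring
  have hpos : 0 < ∫ θ, (θ - m + (b / a * Real.exp (-1 * θ) - 1)) ^ 2 ∂ν := by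
    refine lt_of_le_of_ne (integral_nonneg fun θ => sq_nonneg _) fun h0 => ?_
    have hae := (integral_eq_zero_iff_of_nonneg (fun θ => sq_nonneg _) hint).1 h0.symm
    have hvol := (volume_absolutelyContinuous_logInvGamma ha hb).ae_le hae
    have heq : (fun θ : ℝ => (θ - m + (b / a * Real.exp (-1 * θ) - 1)) ^ 2) = 0 :=
      Continuous.ae_eq_iff_eq volume (by fun_prop) continuous_zero |>.1 hvol
    have hz : ∀ θ : ℝ, θ - m + (b / a * Real.exp (-1 * θ) - 1) = 0 := fun θ =>
      pow_eq_zero_iff two_ne_zero |>.1 (congrFun heq θ)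
    have z0 := hz 0
    have z1 := hz 1
    have z2 := hz 2
    have hE : Real.exp (-1 * 2) = Real.exp (-1 * 1) ^ 2 := by
      rw [← Real.exp_nat_mul]; norm_num
    have hlt : Real.exp (-1 * 1) < 1 := by rw [Real.exp_lt_one_iff]; norm_num
    rw [hE] at z2
    rw [mul_zero, Real.exp_zero] at z0
    have hsq : b / a * (1 - Real.exp (-1 * 1)) ^ 2 = 0 := by linarith
    have : 0 < b / a * (1 - Real.exp (-1 * 1)) ^ 2 :=
      mul_pos (by positivity) (pow_pos (by linarith) 2)
    linarith
  rw [hval] at hpos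
  rw [varKL]
  linarith

/-! ### Gaussian moments -/

section GaussianMoments

variable {μ : ℝ} {v : ℝ≥0}

lemma integral_exp_neg_gaussianReal :
    ∫ θ, Real.exp (-1 * θ) ∂(gaussianReal μ v) = Real.exp (-μ + v / 2) := by
  have h := congrFun (mgf_fun_id_gaussianReal (μ := μ) (v := v)) (-1)
  rw [mgf] at h
  rw [h]
  congr 1
  ring

lemma integral_exp_neg_two_mul_gaussianReal :
    ∫ θ, Real.exp (-2 * θ) ∂(gaussianReal μ v) = Real.exp (-2 * μ + 2 * v) := by
  have h := congrFun (mgf_fun_id_gaussianReal (μ := μ) (v := v)) (-2)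
  rw [mgf] at h
  rw [h]
  congr 1
  ring

lemma integrable_mul_exp_neg_gaussianReal :
    Integrable (fun θ : ℝ => θ * Real.exp (-1 * θ)) (gaussianReal μ v) := by
  have h : (-1 : ℝ) ∈ interior (integrableExpSet (fun θ : ℝ => θ) (gaussianReal μ v)) := by simp
  simpa using integrable_pow_mul_exp_of_mem_interior_integrableExpSet h 1

lemma integral_mul_exp_neg_gaussianReal :
    ∫ θ, θ * Real.exp (-1 * θ) ∂(gaussianReal μ v) = (μ - v) * Real.exp (-μ + v / 2) := by
  have h : (-1 : ℝ) ∈ interior (integrableExpSet (fun θ : ℝ => θ) (gaussianReal μ v)) := by simp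
  have h1 := hasDerivAt_mgf h
  rw [mgf_fun_id_gaussianReal] at h1
  have h2 : HasDerivAt (fun t : ℝ => μ * t + v * t ^ 2 / 2) (μ - v) (-1) := by
    convert! ((hasDerivAt_id' (-1 : ℝ)).const_mul μ).fun_add
      ((((hasDerivAt_id' (-1 : ℝ)).fun_pow 2).const_mul (v : ℝ)).div_const 2) using 1
    push_cast
    ring
  rw [h1.unique h2.exp, mul_comm]
  congr 2
  ring

lemma integrable_id_gaussianReal : Integrable (fun θ : ℝ => θ) (gaussianReal μ v) :=
  (memLp_id_gaussianReal 1).integrable (by norm_num)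

lemma integrable_sub_sq_gaussianReal :
    Integrable (fun θ : ℝ => (θ - μ) ^ 2) (gaussianReal μ v) :=
  ((memLp_id_gaussianReal 2).sub (memLp_const μ)).integrable_sq

lemma integral_sub_sq_gaussianReal : ∫ θ, (θ - μ) ^ 2 ∂(gaussianReal μ v) = v := by
  have h := variance_fun_id_gaussianReal (μ := μ) (v := v)
  rwa [variance_eq_integral aemeasurable_id', integral_id_gaussianReal] at h

end GaussianMoments

/-! ### Closed forms of the objectives -/

lemma log_gaussianPDFReal (μ : ℝ) {v : ℝ} (hv : 0 < v) (θ : ℝ) :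
    Real.log (gaussianPDFReal μ v.toNNReal θ) =
      -Real.log (Real.sqrt (2 * Real.pi * v)) - (θ - μ) ^ 2 / (2 * v) := by
  have h : 0 < Real.sqrt (2 * Real.pi * v) := by positivity
  rw [gaussianPDFReal, Real.coe_toNNReal _ hv.le, Real.log_mul (by positivity) (Real.exp_ne_zero _),
    Real.log_inv, Real.log_exp]
  ring

lemma log_logInvGammaPDF {a b : ℝ} (ha : 0 < a) (hb : 0 < b) (θ : ℝ) :
    Real.log (logInvGammaPDF a b θ) =
      Real.log (b ^ a / Real.Gamma a) - a * θ - b * Real.exp (-1 * θ) := by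
  have hC : 0 < b ^ a / Real.Gamma a :=
    div_pos (Real.rpow_pos_of_pos hb a) (Real.Gamma_pos_of_pos ha)
  rw [logInvGammaPDF, Real.log_mul hC.ne' (Real.exp_ne_zero _), Real.log_exp, neg_one_mul]
  ring

/-- The Kullback-Leibler divergence from `N(μ, σ²)` to the target, in closed form. -/
noncomputable def gaussianKL (a b : ℝ) (x : ℝ × ℝ) : ℝ :=
  -Real.log (Real.sqrt (2 * Real.pi * x.2)) - 1 / 2 - Real.log (b ^ a / Real.Gamma a) + a * x.1 +
    b * Real.exp (-x.1 + x.2 / 2)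

/-- The Fisher divergence from `N(μ, σ²)` to the target, in closed form. -/
noncomputable def gaussianFD (a b : ℝ) (x : ℝ × ℝ) : ℝ :=
  1 / x.2 + a ^ 2 + b ^ 2 * Real.exp (-2 * x.1 + 2 * x.2) -
    2 * (a + 1) * b * Real.exp (-x.1 + x.2 / 2)

lemma llr_gaussianReal_logInvGamma {a b v : ℝ} (ha : 0 < a) (hb : 0 < b) (μ : ℝ) (hv : 0 < v) :
    llr (gaussianReal μ v.toNNReal) (logInvGamma a b) =ᵐ[gaussianReal μ v.toNNReal]
      fun θ => -(1 / (2 * v)) * (θ - μ) ^ 2 + a * θ + b * Real.exp (-1 * θ) +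
        (-Real.log (Real.sqrt (2 * Real.pi * v)) - Real.log (b ^ a / Real.Gamma a)) := by
  have hv' : v.toNNReal ≠ 0 := by simpa using hv
  have h1 := Measure.rnDeriv_withDensity_right (gaussianReal μ v.toNNReal) volume
    (measurable_ofReal_logInvGammaPDF a b).aemeasurable
    (ae_of_all _ fun θ => by simpa using logInvGammaPDF_pos ha hb θ)
    (ae_of_all _ fun θ => ENNReal.ofReal_ne_top)
  refine (gaussianReal_absolutelyContinuous μ hv').ae_eq ?_
  filter_upwards [h1, rnDeriv_gaussianReal μ v.toNNReal] with θ hθ1 hθ2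
  rw [llr, logInvGamma, hθ1, hθ2, ENNReal.toReal_mul, ENNReal.toReal_inv,
    ENNReal.toReal_ofReal (logInvGammaPDF_pos ha hb θ).le, toReal_gaussianPDF,
    Real.log_mul (inv_ne_zero (logInvGammaPDF_pos ha hb θ).ne')
      (gaussianPDFReal_pos _ _ _ hv').ne',
    Real.log_inv, log_gaussianPDFReal μ hv, log_logInvGammaPDF ha hb]
  ring

lemma klObjective_eq {a b : ℝ} (ha : 0 < a) (hb : 0 < b) {x : ℝ × ℝ} (hx : x ∈ gaussianParams) :
    klObjective a b x = ENNReal.ofReal (gaussianKL a b x) ∧ 0 ≤ gaussianKL a b x := by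
  obtain ⟨μ, v⟩ := x
  have hv : 0 < v := hx
  have hv' : v.toNNReal ≠ 0 := by simpa using hv
  have := isProbabilityMeasure_logInvGamma ha hb
  have hac : gaussianReal μ v.toNNReal ≪ logInvGamma a b :=
    (gaussianReal_absolutelyContinuous μ hv').trans (volume_absolutelyContinuous_logInvGamma ha hb)
  have hllr := llr_gaussianReal_logInvGamma ha hb μ hv
  have i1 := (integrable_sub_sq_gaussianReal (μ := μ) (v := v.toNNReal)).const_mul (-(1 / (2 * v)))
  have i2 := (integrable_id_gaussianReal (μ := μ) (v := v.toNNReal)).const_mul a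
  have i3 := (integrable_exp_mul_gaussianReal (μ := μ) (v := v.toNNReal) (-1)).const_mul b
  have s1 := i1.fun_add i2
  have s2 := s1.fun_add i3
  have hint : Integrable (llr (gaussianReal μ v.toNNReal) (logInvGamma a b))
      (gaussianReal μ v.toNNReal) :=
    (integrable_congr hllr).2 (s2.add (integrable_const _))
  have hval : ∫ θ, llr (gaussianReal μ v.toNNReal) (logInvGamma a b) θ ∂(gaussianReal μ v.toNNReal)
      = gaussianKL a b (μ, v) := by
    have hlin : ∫ θ : ℝ, a * θ ∂(gaussianReal μ v.toNNReal) = a * μ := by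
      rw [integral_const_mul, integral_id_gaussianReal]
    rw [integral_congr_ae hllr, integral_add s2 (integrable_const _), integral_add s1 i3,
      integral_add i1 i2, hlin]
    simp only [integral_const_mul, integral_const, probReal_univ, one_smul]
    rw [integral_sub_sq_gaussianReal, integral_exp_neg_gaussianReal,
      Real.coe_toNNReal _ hv.le, gaussianKL]
    field_simp
    ring
  have hnn := InformationTheory.integral_llr_add_sub_measure_univ_nonneg hac hint
  rw [hval, probReal_univ, probReal_univ, add_sub_cancel_right] at hnn
  refine ⟨?_, hnn⟩
  rw [klObjective, InformationTheory.klDiv_of_ac_of_integrable hac hint, hval, probReal_univ,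
    probReal_univ, add_sub_cancel_right]

lemma deriv_log_gaussianPDFReal_div {a b v : ℝ} (ha : 0 < a) (hb : 0 < b) (μ : ℝ) (hv : 0 < v)
    (θ : ℝ) :
    deriv (fun t => Real.log (gaussianPDFReal μ v.toNNReal t / logInvGammaPDF a b t)) θ =
      -(θ - μ) / v + a - b * Real.exp (-1 * θ) := by
  have hv' : v.toNNReal ≠ 0 := by simpa using hv
  have hfun : (fun t => Real.log (gaussianPDFReal μ v.toNNReal t / logInvGammaPDF a b t)) =
      fun t => (-Real.log (Real.sqrt (2 * Real.pi * v)) - (t - μ) ^ 2 / (2 * v)) -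
        (Real.log (b ^ a / Real.Gamma a) - a * t - b * Real.exp (-1 * t)) := by
    funext t
    rw [Real.log_div (gaussianPDFReal_pos _ _ _ hv').ne' (logInvGammaPDF_pos ha hb t).ne',
      log_gaussianPDFReal μ hv, log_logInvGammaPDF ha hb]
  rw [hfun]
  refine HasDerivAt.deriv ?_
  have e1 := ((((hasDerivAt_id' θ).sub_const μ).fun_pow 2).div_const (2 * v)).const_sub
    (-Real.log (Real.sqrt (2 * Real.pi * v)))
  have e2 := (((hasDerivAt_id' θ).const_mul a).const_sub (Real.log (b ^ a / Real.Gamma a))).fun_sub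
    ((((hasDerivAt_id' θ).const_mul (-1)).exp).const_mul b)
  convert! e1.fun_sub e2 using 1
  push_cast
  field_simp
  ring

lemma integral_score_sq {a b v : ℝ} (μ : ℝ) (hv : 0 < v) :
    Integrable (fun θ => (-(θ - μ) / v + a - b * Real.exp (-1 * θ)) ^ 2)
      (gaussianReal μ v.toNNReal) ∧
    ∫ θ, (-(θ - μ) / v + a - b * Real.exp (-1 * θ)) ^ 2 ∂(gaussianReal μ v.toNNReal) =
      gaussianFD a b (μ, v) := by
  have hexpand : ∀ θ : ℝ, (-(θ - μ) / v + a - b * Real.exp (-1 * θ)) ^ 2 =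
      1 / v ^ 2 * (θ - μ) ^ 2 + 2 * b / v * (θ * Real.exp (-1 * θ)) +
      (-2 * b * μ / v - 2 * a * b) * Real.exp (-1 * θ) + b ^ 2 * Real.exp (-2 * θ) +
      (-2 * a / v) * θ + (2 * a * μ / v + a ^ 2) := fun θ => by
    have : Real.exp (-2 * θ) = Real.exp (-1 * θ) ^ 2 := by
      rw [← Real.exp_nat_mul]; congr 1; push_cast; ring
    rw [this]
    ring
  have i1 := (integrable_sub_sq_gaussianReal (μ := μ) (v := v.toNNReal)).const_mul (1 / v ^ 2)
  have i2 := (integrable_mul_exp_neg_gaussianReal (μ := μ) (v := v.toNNReal)).const_mul (2 * b / v)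
  have i3 := (integrable_exp_mul_gaussianReal (μ := μ) (v := v.toNNReal) (-1)).const_mul
    (-2 * b * μ / v - 2 * a * b)
  have i4 := (integrable_exp_mul_gaussianReal (μ := μ) (v := v.toNNReal) (-2)).const_mul (b ^ 2)
  have i5 := (integrable_id_gaussianReal (μ := μ) (v := v.toNNReal)).const_mul (-2 * a / v)
  have s1 := i1.fun_add i2
  have s2 := s1.fun_add i3
  have s3 := s2.fun_add i4
  have s4 := s3.fun_add i5
  simp_rw [hexpand]
  refine ⟨s4.add (integrable_const _), ?_⟩
  have hlin : ∫ θ : ℝ, -2 * a / v * θ ∂(gaussianReal μ v.toNNReal) = -2 * a / v * μ := by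
    rw [integral_const_mul, integral_id_gaussianReal]
  rw [integral_add s4 (integrable_const _), integral_add s3 i5, integral_add s2 i4,
    integral_add s1 i3, integral_add i1 i2, hlin]
  simp only [integral_const_mul, integral_const, probReal_univ, one_smul]
  rw [integral_sub_sq_gaussianReal, integral_mul_exp_neg_gaussianReal,
    integral_exp_neg_gaussianReal, integral_exp_neg_two_mul_gaussianReal,
    Real.coe_toNNReal _ hv.le, gaussianFD]
  field_simp
  ring

lemma gaussianFD_nonneg {a b : ℝ} {x : ℝ × ℝ} (hx : x ∈ gaussianParams) :
    0 ≤ gaussianFD a b x := by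
  rw [← (integral_score_sq (a := a) (b := b) x.1 hx).2]
  exact integral_nonneg fun θ => sq_nonneg _

lemma weightedFisherDiv_gaussian_logInvGamma {a b : ℝ} (ha : 0 < a) (hb : 0 < b) (M : ℝ≥0)
    {x : ℝ × ℝ} (hx : x ∈ gaussianParams) :
    weightedFisherDiv M (gaussianPDFReal x.1 x.2.toNNReal) (logInvGammaPDF a b) =
      ENNReal.ofReal (M * gaussianFD a b x) := by
  obtain ⟨μ, v⟩ := x
  have hv : 0 < v := hx
  have hv' : v.toNNReal ≠ 0 := by simpa using hv
  obtain ⟨hi, hval⟩ := integral_score_sq (a := a) (b := b) μ hv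
  rw [← hval, ← integral_const_mul, ofReal_integral_eq_lintegral_ofReal (hi.const_mul _)
    (ae_of_all _ fun θ => by positivity), gaussianReal_of_var_ne_zero _ hv',
    lintegral_withDensity_eq_lintegral_mul _ (measurable_gaussianPDF _ _) (by fun_prop),
    weightedFisherDiv]
  refine lintegral_congr fun θ => ?_
  rw [Pi.mul_apply, gaussianPDF, ← ENNReal.ofReal_mul (gaussianPDFReal_nonneg _ _ _),
    deriv_log_gaussianPDFReal_div ha hb μ hv]

lemma fdObjective_eq {a b : ℝ} (ha : 0 < a) (hb : 0 < b) {x : ℝ × ℝ} (hx : x ∈ gaussianParams) :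
    fdObjective a b x = ENNReal.ofReal (gaussianFD a b x) := by
  rw [fdObjective, weightedFisherDiv_gaussian_logInvGamma ha hb 1 hx, NNReal.coe_one, one_mul]

lemma sdObjective_eq {a b : ℝ} (ha : 0 < a) (hb : 0 < b) {x : ℝ × ℝ} (hx : x ∈ gaussianParams) :
    sdObjective a b x = ENNReal.ofReal (x.2 * gaussianFD a b x) := by
  rw [sdObjective, weightedFisherDiv_gaussian_logInvGamma ha hb _ hx, Real.coe_toNNReal _ (le_of_lt hx)]

/-! ### Minimizers -/

lemma isOptimal_iff_of_strict {D : ℝ × ℝ → ℝ≥0∞} {G : ℝ × ℝ → ℝ} {x₀ : ℝ × ℝ}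
    (hD : ∀ x ∈ gaussianParams, D x = ENNReal.ofReal (G x)) (hx₀ : x₀ ∈ gaussianParams)
    (h0 : 0 ≤ G x₀) (hG : ∀ y ∈ gaussianParams, y ≠ x₀ → G x₀ < G y) (x : ℝ × ℝ) :
    IsOptimal D x ↔ x = x₀ := by
  have key : ∀ y ∈ gaussianParams, y ≠ x₀ → D x₀ < D y := fun y hy hne => by
    rw [hD y hy, hD x₀ hx₀]
    exact (ENNReal.ofReal_lt_ofReal_iff (h0.trans_lt (hG y hy hne))).2 (hG y hy hne)
  constructor
  · rintro ⟨hx, hmin⟩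
    by_contra hne
    exact absurd (hmin hx₀) (not_le.2 (key x hx hne))
  · rintro rfl
    refine ⟨hx₀, fun y hy => ?_⟩
    rcases eq_or_ne y x with h | h
    · exact (congrArg D h).ge
    · exact (key y hy h).le

lemma gaussianKL_optimal_lt {a b : ℝ} (ha : 0 < a) (hb : 0 < b) {y : ℝ × ℝ}
    (hy : y ∈ gaussianParams) (hne : y ≠ (meanKL a b, varKL a)) :
    gaussianKL a b (meanKL a b, varKL a) < gaussianKL a b y := by
  obtain ⟨μ, v⟩ := y
  have hv : 0 < v := hy
  have hlogv : ∀ w : ℝ, 0 < w → Real.log (Real.sqrt (2 * Real.pi * w)) =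
      Real.log (2 * Real.pi) / 2 + Real.log w / 2 := fun w hw => by
    rw [Real.log_sqrt (by positivity), Real.log_mul (by positivity) hw.ne']
    ring
  have hbexp : ∀ u w : ℝ, b * Real.exp (-u + w / 2) = Real.exp (Real.log b - u + w / 2) :=
    fun u w => by
      rw [show Real.log b - u + w / 2 = Real.log b + (-u + w / 2) by ring, Real.exp_add (Real.log b),
        Real.exp_log hb]
  set c := Real.log b - Real.log a - μ + v / 2 with hc
  have hexpc : b * Real.exp (-μ + v / 2) = a * Real.exp c := by
    rw [hbexp, show Real.log b - μ + v / 2 = Real.log a + c by rw [hc]; ring, Real.exp_add,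
      Real.exp_log ha]
  have hopt : b * Real.exp (-meanKL a b + varKL a / 2) = a := by
    rw [hbexp, meanKL, varKL, Real.log_div hb.ne' ha.ne']
    conv_rhs => rw [← Real.exp_log ha]
    congr 1
    field_simp
    ring
  have h1 : c + 1 ≤ Real.exp c := Real.add_one_le_exp c
  have h2 : Real.log (a * v) ≤ a * v - 1 := Real.log_le_sub_one_of_pos (by positivity)
  have hstrict : c + 1 < Real.exp c ∨ Real.log (a * v) < a * v - 1 := by
    by_contra! hcon
    have hc0 : c = 0 := by
      by_contra h
      exact absurd (Real.add_one_lt_exp h) (not_lt.2 hcon.1)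
    have hav : a * v = 1 := by
      by_contra h
      exact absurd (Real.log_lt_sub_one_of_pos (by positivity) h) (not_lt.2 hcon.2)
    have hvv : v = 1 / a := by rw [eq_div_iff ha.ne']; linarith
    refine hne (Prod.ext ?_ hvv)
    simp only [meanKL]
    rw [Real.log_div hb.ne' ha.ne']
    have : 1 / (2 * a) = v / 2 := by rw [hvv]; field_simp
    linarith
  rw [Real.log_mul ha.ne' hv.ne'] at h2 hstrict
  have hsum : a * c + a + (Real.log a + Real.log v) / 2 < a * Real.exp c + (a * v - 1) / 2 := by
    rcases hstrict with h | h
    · have := mul_lt_mul_of_pos_left h ha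
      linarith
    · have := mul_le_mul_of_nonneg_left h1 ha.le
      linarith
  simp only [gaussianKL]
  rw [hlogv v hv, hlogv _ (by rw [varKL]; positivity), hexpc, hopt, meanKL, varKL,
    Real.log_div hb.ne' ha.ne', one_div, Real.log_inv]
  have e1 : a * (Real.log b - Real.log a + 1 / (2 * a)) = a * Real.log b - a * Real.log a + 1 / 2 := by
    field_simp
  have e2 : a * c = a * Real.log b - a * Real.log a - a * μ + a * v / 2 := by rw [hc]; ring
  rw [e1]
  linarith

lemma isOptimal_klObjective_iff {a b : ℝ} (ha : 0 < a) (hb : 0 < b) (x : ℝ × ℝ) :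
    IsOptimal (klObjective a b) x ↔ x = (meanKL a b, varKL a) := by
  have hmem : (meanKL a b, varKL a) ∈ gaussianParams := show 0 < varKL a by rw [varKL]; positivity
  exact isOptimal_iff_of_strict (fun y hy => (klObjective_eq ha hb hy).1) hmem
    (klObjective_eq ha hb hmem).2 (fun y hy => gaussianKL_optimal_lt ha hb hy) x

/-- The minimum of the Fisher divergence over the means, as a function of the variance. -/
noncomputable def fdProfile (a v : ℝ) : ℝ := 1 / v + a ^ 2 - (a + 1) ^ 2 * Real.exp (-v)

/-- The mean minimizing the Fisher divergence for a given variance. -/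
noncomputable def fdMean (a b v : ℝ) : ℝ := Real.log (b / (a + 1)) + 3 * v / 2

lemma gaussianFD_eq_fdProfile_add (a b μ v : ℝ) :
    gaussianFD a b (μ, v) = fdProfile a v +
      Real.exp v * (b * Real.exp (-μ + v / 2) - (a + 1) * Real.exp (-v)) ^ 2 := by
  have h1 : Real.exp (-2 * μ + 2 * v) = Real.exp v * Real.exp (-μ + v / 2) ^ 2 := by
    rw [← Real.exp_nat_mul, ← Real.exp_add]; congr 1; push_cast; ring
  have h2 : Real.exp v * Real.exp (-v) = 1 := by rw [← Real.exp_add]; simp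
  rw [gaussianFD, fdProfile]
  dsimp only
  rw [h1]
  linear_combination (2 * b * (a + 1) * Real.exp (-μ + v / 2) - (a + 1) ^ 2 * Real.exp (-v)) * h2

lemma mul_exp_eq_iff {a b : ℝ} (ha : 0 < a) (hb : 0 < b) (μ v : ℝ) :
    b * Real.exp (-μ + v / 2) - (a + 1) * Real.exp (-v) = 0 ↔ μ = fdMean a b v := by
  have ha1 : 0 < a + 1 := by linarith
  have e1 : b * Real.exp (-μ + v / 2) = Real.exp (Real.log b + (-μ + v / 2)) := by
    rw [Real.exp_add (Real.log b), Real.exp_log hb]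
  have e2 : (a + 1) * Real.exp (-v) = Real.exp (Real.log (a + 1) + -v) := by
    rw [Real.exp_add, Real.exp_log ha1]
  rw [sub_eq_zero, e1, e2, Real.exp_eq_exp, fdMean, Real.log_div hb.ne' ha1.ne']
  constructor <;> intro h <;> linarith

lemma gaussianFD_fdMean {a b : ℝ} (ha : 0 < a) (hb : 0 < b) (v : ℝ) :
    gaussianFD a b (fdMean a b v, v) = fdProfile a v := by
  rw [gaussianFD_eq_fdProfile_add, (mul_exp_eq_iff ha hb _ v).2 rfl]
  ring

lemma fdProfile_le_gaussianFD (a b μ v : ℝ) : fdProfile a v ≤ gaussianFD a b (μ, v) := by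
  rw [gaussianFD_eq_fdProfile_add]
  have := mul_nonneg (Real.exp_pos v).le
    (sq_nonneg (b * Real.exp (-μ + v / 2) - (a + 1) * Real.exp (-v)))
  linarith

lemma fdProfile_lt_gaussianFD {a b μ v : ℝ} (ha : 0 < a) (hb : 0 < b) (h : μ ≠ fdMean a b v) :
    fdProfile a v < gaussianFD a b (μ, v) := by
  rw [gaussianFD_eq_fdProfile_add]
  have hne := fun h0 => h ((mul_exp_eq_iff ha hb μ v).1 h0)
  have := mul_pos (Real.exp_pos v) (sq_pos_of_ne_zero hne)
  linarith

lemma hasDerivAt_fdProfile (a : ℝ) {v : ℝ} (hv : 0 < v) :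
    HasDerivAt (fdProfile a) ((((a + 1) * (v * Real.exp (-v / 2))) ^ 2 - 1) / v ^ 2) v := by
  have h := ((hasDerivAt_inv hv.ne').add_const (a ^ 2)).fun_sub
    (((hasDerivAt_id' v).fun_neg.exp).const_mul ((a + 1) ^ 2))
  have hE : Real.exp (-v / 2) ^ 2 = Real.exp (-v) := by
    rw [← Real.exp_nat_mul]; congr 1; push_cast; ring
  have hfun : fdProfile a = fun v => v⁻¹ + a ^ 2 - (a + 1) ^ 2 * Real.exp (-v) := by
    funext w
    rw [fdProfile, one_div]
  rw [hfun]
  refine h.congr_deriv ?_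
  rw [mul_pow, mul_pow, hE]
  field_simp
  ring

lemma fdProfile_continuousOn (a : ℝ) {s : Set ℝ} (hs : s ⊆ Set.Ioi 0) :
    ContinuousOn (fdProfile a) s := fun _ hv =>
  (hasDerivAt_fdProfile a (hs hv)).continuousAt.continuousWithinAt

lemma fdProfile_lt_of_lt_varFD {a v : ℝ} (ha : 1 / 2 < a) (hv : 0 < v) (h : v < varFD a) :
    fdProfile a (varFD a) < fdProfile a v := by
  obtain ⟨h1, h2, h3⟩ := varFD_spec ha
  have hanti : StrictAntiOn (fdProfile a) (Set.Icc v (varFD a)) := by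
    refine strictAntiOn_of_deriv_neg (convex_Icc _ _)
      (fdProfile_continuousOn a fun w hw => hv.trans_le hw.1) fun w hw => ?_
    rw [interior_Icc] at hw
    have hw0 : 0 < w := hv.trans hw.1
    rw [(hasDerivAt_fdProfile a hw0).deriv]
    refine div_neg_of_neg_of_pos ?_ (by positivity)
    have hlt : (a + 1) * (w * Real.exp (-w / 2)) < 1 := by
      refine lt_of_lt_of_eq ?_ h3
      exact mul_lt_mul_of_pos_left (strictMonoOn_mul_exp_neg_half ⟨hw0.le, by linarith [hw.2]⟩
        ⟨h1.le, h2.le⟩ hw.2) (by linarith)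
    have h0 : 0 ≤ (a + 1) * (w * Real.exp (-w / 2)) := by positivity
    nlinarith
  exact hanti ⟨le_rfl, h.le⟩ ⟨h.le, le_rfl⟩ h

lemma fdProfile_lt_of_varFD_lt {a v : ℝ} (ha : 1 / 2 < a) (h : varFD a < v)
    (hv : v ≤ 2 ∨ 1 ≤ (a + 1) * (v * Real.exp (-v / 2))) :
    fdProfile a (varFD a) < fdProfile a v := by
  obtain ⟨h1, h2, h3⟩ := varFD_spec ha
  have hmono : StrictMonoOn (fdProfile a) (Set.Icc (varFD a) v) := by
    refine strictMonoOn_of_deriv_pos (convex_Icc _ _)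
      (fdProfile_continuousOn a fun w hw => h1.trans_le hw.1) fun w hw => ?_
    rw [interior_Icc] at hw
    have hw0 : 0 < w := h1.trans hw.1
    rw [(hasDerivAt_fdProfile a hw0).deriv]
    refine div_pos ?_ (by positivity)
    have hlt : 1 < (a + 1) * (w * Real.exp (-w / 2)) := by
      rcases le_or_gt w 2 with hw2 | hw2
      · refine h3.symm.trans_lt ?_
        exact mul_lt_mul_of_pos_left (strictMonoOn_mul_exp_neg_half ⟨h1.le, h2.le⟩
          ⟨hw0.le, hw2⟩ hw.1) (by linarith)
      · rcases hv with hv | hv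
        · linarith [hw.2]
        · exact hv.trans_lt (mul_lt_mul_of_pos_left (strictAntiOn_mul_exp_neg_half
            (Set.mem_Ici.2 hw2.le) (Set.mem_Ici.2 (hw2.trans hw.2).le) hw.2) (by linarith))
    nlinarith
  exact hmono ⟨le_rfl, h.le⟩ ⟨h.le, le_rfl⟩ h

lemma fdProfile_varFD {a : ℝ} (ha : 1 / 2 < a) :
    fdProfile a (varFD a) = a ^ 2 + (varFD a - 1) / varFD a ^ 2 := by
  obtain ⟨h1, h2, h3⟩ := varFD_spec ha
  have hE : Real.exp (-varFD a / 2) ^ 2 = Real.exp (-varFD a) := by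
    rw [← Real.exp_nat_mul]; congr 1; push_cast; ring
  have h4 : (a + 1) ^ 2 * Real.exp (-varFD a) = 1 / varFD a ^ 2 := by
    rw [eq_div_iff (by positivity), ← hE]
    calc _ = ((a + 1) * (varFD a * Real.exp (-(varFD a) / 2))) ^ 2 := by ring
      _ = 1 := by rw [h3, one_pow]
  rw [fdProfile, h4]
  field_simp
  ring

lemma fdProfile_varFD_lt {a v : ℝ} (ha : 1 / 2 < a) (hF : varFD a ≤ 1) (hv : 0 < v)
    (hne : v ≠ varFD a) : fdProfile a (varFD a) < fdProfile a v := by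
  obtain ⟨h1, h2, h3⟩ := varFD_spec ha
  rcases lt_or_gt_of_ne hne with h | h
  · exact fdProfile_lt_of_lt_varFD ha hv h
  by_cases hcase : v ≤ 2 ∨ 1 ≤ (a + 1) * (v * Real.exp (-v / 2))
  · exact fdProfile_lt_of_varFD_lt ha h hcase
  push Not at hcase
  obtain ⟨hv2, hlt⟩ := hcase
  have hE : Real.exp (-v / 2) ^ 2 = Real.exp (-v) := by
    rw [← Real.exp_nat_mul]; congr 1; push_cast; ring
  have h0 : 0 ≤ (a + 1) * (v * Real.exp (-v / 2)) := by positivity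
  have h4 : (a + 1) ^ 2 * Real.exp (-v) < 1 / v := by
    rw [lt_div_iff₀ hv, ← hE]
    have h5 : v * ((a + 1) ^ 2 * Real.exp (-v / 2) ^ 2 * v) < 1 := by nlinarith
    have h6 : 0 ≤ (a + 1) ^ 2 * Real.exp (-v / 2) ^ 2 * v := by positivity
    nlinarith
  have h7 : (varFD a - 1) / varFD a ^ 2 ≤ 0 :=
    div_nonpos_of_nonpos_of_nonneg (by linarith) (by positivity)
  rw [fdProfile_varFD ha, fdProfile]
  linarith

lemma meanFD_eq_fdMean (a b : ℝ) : meanFD a b = fdMean a b (varFD a) := rfl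

lemma meanSD_eq_fdMean (a b : ℝ) : meanSD a b = fdMean a b (varSD a) := rfl

lemma eq_of_isLocalMin_fdProfile {a v : ℝ} (ha : 1 / 2 < a) (hv : 0 < v)
    (h : IsLocalMin (fdProfile a) v) : v = varFD a := by
  obtain ⟨h1, h2, h3⟩ := varFD_spec ha
  have hder := h.hasDerivAt_eq_zero (hasDerivAt_fdProfile a hv)
  have hpos : 0 < (a + 1) * (v * Real.exp (-v / 2)) := by positivity
  have hone : (a + 1) * (v * Real.exp (-v / 2)) = 1 := by
    rw [div_eq_zero_iff, or_iff_left (by positivity)] at hder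
    nlinarith
  rcases le_or_gt v 2 with hv2 | hv2
  · refine strictMonoOn_mul_exp_neg_half.injOn ⟨hv.le, hv2⟩ ⟨h1.le, h2.le⟩ ?_
    exact mul_left_cancel₀ (show a + 1 ≠ 0 by linarith) (hone.trans h3.symm)
  · exfalso
    have hanti : StrictAntiOn (fdProfile a) (Set.Ici v) := by
      refine strictAntiOn_of_deriv_neg (convex_Ici _)
        (fdProfile_continuousOn a fun w hw => hv.trans_le hw) fun w hw => ?_
      rw [interior_Ici] at hw
      have hwv : v < w := hw
      have hw0 : 0 < w := hv.trans hwv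
      rw [(hasDerivAt_fdProfile a hw0).deriv]
      refine div_neg_of_neg_of_pos ?_ (by positivity)
      have hlt : (a + 1) * (w * Real.exp (-w / 2)) < 1 := by
        refine lt_of_lt_of_eq ?_ hone
        exact mul_lt_mul_of_pos_left (strictAntiOn_mul_exp_neg_half
          (Set.mem_Ici.2 hv2.le) (Set.mem_Ici.2 (hv2.trans hwv).le) hwv) (by linarith)
      have h0 : 0 ≤ (a + 1) * (w * Real.exp (-w / 2)) := by positivity
      nlinarith
    have hev : ∀ᶠ w in nhdsWithin v (Set.Ioi v), fdProfile a v ≤ fdProfile a w :=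
      nhdsWithin_le_nhds h
    obtain ⟨w, hw, hwv⟩ := (hev.and self_mem_nhdsWithin).exists
    exact absurd (hanti (Set.mem_Ici.2 le_rfl) (Set.mem_Ici.2 (le_of_lt hwv)) hwv) (not_lt.2 hw)

lemma isOpen_gaussianParams : IsOpen gaussianParams := isOpen_lt continuous_const continuous_snd

lemma isLocallyOptimal_fdObjective_iff_isLocalMin {a b : ℝ} (ha : 0 < a) (hb : 0 < b)
    {x : ℝ × ℝ} (hx : x ∈ gaussianParams) :
    IsLocallyOptimal (fdObjective a b) x ↔ IsLocalMin (gaussianFD a b) x := by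
  rw [IsLocallyOptimal, and_iff_right hx, IsLocalMinOn, IsMinFilter,
    isOpen_gaussianParams.nhdsWithin_eq hx]
  refine Filter.eventually_congr ?_
  filter_upwards [isOpen_gaussianParams.mem_nhds hx] with y hy
  rw [fdObjective_eq ha hb hx, fdObjective_eq ha hb hy,
    ENNReal.ofReal_le_ofReal_iff (gaussianFD_nonneg hy)]

lemma eq_fdMean_of_isLocalMin {a b μ v : ℝ} (ha : 0 < a) (hb : 0 < b)
    (h : IsLocalMin (gaussianFD a b) (μ, v)) : μ = fdMean a b v := by
  have hcont : ContinuousAt (fun s : ℝ => (s, v)) μ := by fun_prop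
  have h1 : IsLocalMin (fun s => gaussianFD a b (s, v)) μ := hcont.eventually h
  set c := (a + 1) * Real.exp (-v) with hc
  have hfun : (fun s => gaussianFD a b (s, v)) =
      fun s => fdProfile a v + Real.exp v * (b * Real.exp (-s + v / 2) - c) ^ 2 := by
    funext s
    rw [gaussianFD_eq_fdProfile_add]
  rw [hfun] at h1
  have hder : HasDerivAt
      (fun s => fdProfile a v + Real.exp v * (b * Real.exp (-s + v / 2) - c) ^ 2)
      (-(2 * Real.exp v * (b * Real.exp (-μ + v / 2)) * (b * Real.exp (-μ + v / 2) - c))) μ := by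
    have := (((((((hasDerivAt_id' μ).fun_neg.add_const (v / 2)).exp).const_mul b).sub_const
      c).fun_pow 2).const_mul (Real.exp v)).const_add (fdProfile a v)
    refine this.congr_deriv ?_
    push_cast
    ring
  have h0 := h1.hasDerivAt_eq_zero hder
  rw [neg_eq_zero] at h0
  have hpos : 2 * Real.exp v * (b * Real.exp (-μ + v / 2)) ≠ 0 := by positivity
  exact (mul_exp_eq_iff ha hb μ v).1 ((mul_eq_zero_iff_left hpos).1 h0)

lemma isLocallyOptimal_fdObjective_iff {a b : ℝ} (ha : 1 / 2 < a) (hb : 0 < b) (x : ℝ × ℝ) :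
    IsLocallyOptimal (fdObjective a b) x ↔ x = (meanFD a b, varFD a) := by
  have ha0 : 0 < a := by linarith
  obtain ⟨h1, h2, h3⟩ := varFD_spec ha
  constructor
  · intro h
    obtain ⟨μ, v⟩ := x
    have hx := h.1
    have hv : 0 < v := hx
    rw [isLocallyOptimal_fdObjective_iff_isLocalMin ha0 hb hx] at h
    have hμ := eq_fdMean_of_isLocalMin ha0 hb h
    subst hμ
    have hcont : ContinuousAt (fun w : ℝ => (fdMean a b w, w)) v := by
      unfold fdMean
      fun_prop
    have hmin : IsLocalMin (fdProfile a) v := by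
      filter_upwards [hcont.eventually h] with w hw
      rwa [gaussianFD_fdMean ha0 hb, gaussianFD_fdMean ha0 hb] at hw
    have hvF := eq_of_isLocalMin_fdProfile ha hv hmin
    rw [hvF]
    rfl
  · rintro rfl
    have hmem : (meanFD a b, varFD a) ∈ gaussianParams := h1
    rw [isLocallyOptimal_fdObjective_iff_isLocalMin ha0 hb hmem]
    have hnhds : {y : ℝ × ℝ | 0 < y.2 ∧ y.2 < 2} ∈ nhds (meanFD a b, varFD a) :=
      (isOpen_gaussianParams.inter (isOpen_lt continuous_snd continuous_const)).mem_nhds ⟨h1, h2⟩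
    filter_upwards [hnhds] with y hy
    rw [meanFD_eq_fdMean, gaussianFD_fdMean ha0 hb]
    refine le_trans ?_ (fdProfile_le_gaussianFD a b y.1 y.2)
    rcases lt_trichotomy y.2 (varFD a) with h | h | h
    · exact (fdProfile_lt_of_lt_varFD ha hy.1 h).le
    · rw [h]
    · exact (fdProfile_lt_of_varFD_lt ha h (Or.inl hy.2.le)).le

lemma isOptimal_fdObjective_iff {a b : ℝ} (ha : 1 / 2 < a) (hb : 0 < b) (x : ℝ × ℝ) :
    IsOptimal (fdObjective a b) x ↔
      Real.sqrt (Real.exp 1) - 1 ≤ a ∧ x = (meanFD a b, varFD a) := by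
  have ha0 : 0 < a := by linarith
  obtain ⟨h1, h2, h3⟩ := varFD_spec ha
  have hmem : (meanFD a b, varFD a) ∈ gaussianParams := h1
  rw [← varFD_le_one_iff ha]
  constructor
  · intro h
    have hx := (isLocallyOptimal_fdObjective_iff ha hb x).1 ⟨h.1, h.2.localize⟩
    refine ⟨?_, hx⟩
    by_contra! hF
    have hd : 0 < (varFD a - 1) / varFD a ^ 2 := div_pos (by linarith) (by positivity)
    set d := (varFD a - 1) / varFD a ^ 2 with hdd
    have hy : (fdMean a b (1 / d), 1 / d) ∈ gaussianParams := show 0 < 1 / d by positivity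
    have hle := h.2 hy
    rw [Set.mem_ofPred_eq, fdObjective_eq ha0 hb h.1, fdObjective_eq ha0 hb hy,
      ENNReal.ofReal_le_ofReal_iff (gaussianFD_nonneg hy), hx, meanFD_eq_fdMean,
      gaussianFD_fdMean ha0 hb, gaussianFD_fdMean ha0 hb, fdProfile_varFD ha, ← hdd, fdProfile,
      one_div_one_div] at hle
    have : 0 < (a + 1) ^ 2 * Real.exp (-(1 / d)) := by positivity
    linarith
  · rintro ⟨hF, hx⟩
    refine (isOptimal_iff_of_strict (fun y hy => fdObjective_eq ha0 hb hy) hmem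
      (gaussianFD_nonneg hmem) (fun y hy hne => ?_) x).2 hx
    rw [meanFD_eq_fdMean, gaussianFD_fdMean ha0 hb]
    by_cases hv : y.2 = varFD a
    · rw [← hv]
      refine fdProfile_lt_gaussianFD ha0 hb fun hμ => hne (Prod.ext ?_ hv)
      rw [hμ, hv]
      rfl
    · exact (fdProfile_varFD_lt ha hF hy hv).trans_le (fdProfile_le_gaussianFD a b y.1 y.2)

lemma hasDerivAt_mul_fdProfile (a v : ℝ) :
    HasDerivAt (fun v => 1 + a ^ 2 * v - (a + 1) ^ 2 * (v * Real.exp (-v)))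
      (a ^ 2 - (a + 1) ^ 2 * ((1 - v) * Real.exp (-v))) v := by
  have h := (((hasDerivAt_id' v).const_mul (a ^ 2)).const_add 1).fun_sub
    (((hasDerivAt_id' v).fun_mul ((hasDerivAt_id' v).fun_neg.exp)).const_mul ((a + 1) ^ 2))
  refine h.congr_deriv ?_
  ring

lemma mul_fdProfile {a v : ℝ} (hv : 0 < v) :
    v * fdProfile a v = 1 + a ^ 2 * v - (a + 1) ^ 2 * (v * Real.exp (-v)) := by
  rw [fdProfile]
  field_simp

lemma mul_fdProfile_varSD_lt {a v : ℝ} (ha : 1 / 2 < a) (hv : 0 < v) (hne : v ≠ varSD a) :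
    varSD a * fdProfile a (varSD a) < v * fdProfile a v := by
  obtain ⟨h1, h2, h3⟩ := varSD_spec ha
  have hpos : 0 < (a + 1) ^ 2 := by positivity
  rw [mul_fdProfile h1, mul_fdProfile hv]
  have hcont : Continuous fun v => 1 + a ^ 2 * v - (a + 1) ^ 2 * (v * Real.exp (-v)) := by fun_prop
  rcases lt_or_gt_of_ne hne with h | h
  · have hanti : StrictAntiOn (fun v => 1 + a ^ 2 * v - (a + 1) ^ 2 * (v * Real.exp (-v)))
        (Set.Iic (varSD a)) := by
      refine strictAntiOn_of_deriv_neg (convex_Iic _) hcont.continuousOn fun w hw => ?_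
      rw [interior_Iic] at hw
      have hwS : w < varSD a := hw
      rw [(hasDerivAt_mul_fdProfile a w).deriv, ← h3]
      have := mul_lt_mul_of_pos_left (strictAntiOn_one_sub_mul_exp_neg
        (Set.mem_Iic.2 (by linarith)) (Set.mem_Iic.2 (by linarith)) hwS) hpos
      linarith
    exact hanti (Set.mem_Iic.2 h.le) (Set.mem_Iic.2 le_rfl) h
  · have hmono : StrictMonoOn (fun v => 1 + a ^ 2 * v - (a + 1) ^ 2 * (v * Real.exp (-v)))
        (Set.Ici (varSD a)) := by
      refine strictMonoOn_of_deriv_pos (convex_Ici _) hcont.continuousOn fun w hw => ?_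
      rw [interior_Ici] at hw
      have hwS : varSD a < w := hw
      rw [(hasDerivAt_mul_fdProfile a w).deriv]
      rcases le_or_gt w 2 with hw2 | hw2
      · rw [← h3]
        have := mul_lt_mul_of_pos_left (strictAntiOn_one_sub_mul_exp_neg
          (Set.mem_Iic.2 (by linarith)) (Set.mem_Iic.2 hw2) hwS) hpos
        linarith
      · have : (a + 1) ^ 2 * ((1 - w) * Real.exp (-w)) ≤ 0 :=
          mul_nonpos_of_nonneg_of_nonpos hpos.le
            (mul_nonpos_of_nonpos_of_nonneg (by linarith) (Real.exp_pos _).le)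
        have : 0 < a ^ 2 := by positivity
        linarith
    exact hmono (Set.mem_Ici.2 le_rfl) (Set.mem_Ici.2 h.le) h

lemma isOptimal_sdObjective_iff {a b : ℝ} (ha : 1 / 2 < a) (hb : 0 < b) (x : ℝ × ℝ) :
    IsOptimal (sdObjective a b) x ↔ x = (meanSD a b, varSD a) := by
  have ha0 : 0 < a := by linarith
  obtain ⟨h1, h2, h3⟩ := varSD_spec ha
  have hmem : (meanSD a b, varSD a) ∈ gaussianParams := h1
  refine isOptimal_iff_of_strict (fun y hy => sdObjective_eq ha0 hb hy) hmem
    (mul_nonneg h1.le (gaussianFD_nonneg hmem)) (fun y hy hne => ?_) x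
  have hy0 : 0 < y.2 := hy
  rw [meanSD_eq_fdMean, gaussianFD_fdMean ha0 hb]
  by_cases hv : y.2 = varSD a
  · rw [← hv]
    refine mul_lt_mul_of_pos_left (fdProfile_lt_gaussianFD ha0 hb fun hμ => hne (Prod.ext ?_ hv)) hy0
    rw [hμ, hv]
    rfl
  · exact (mul_fdProfile_varSD_lt ha hy0 hv).trans_le
      (mul_le_mul_of_nonneg_left (fdProfile_le_gaussianFD a b y.1 y.2) hy0.le)

theorem theorem3 (a b : ℝ) (ha : 1 / 2 < a) (hb : 0 < b) :
    -- the target is the law of `log X`, `X = 1 / Y` inverse gamma, `Y` gamma; it has a mean and a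
    -- variance, and a unique mode
    ((gammaMeasure a b).map (fun y => Real.log y⁻¹) = logInvGamma a b ∧
      IsProbabilityMeasure (logInvGamma a b) ∧
      MemLp (fun θ : ℝ => θ) 2 (logInvGamma a b) ∧
      ∃! m : ℝ, IsMode (logInvGammaPDF a b) m) ∧
    -- the optimal parameters, in closed form
    (∀ x : ℝ × ℝ, IsOptimal (klObjective a b) x ↔ x = (meanKL a b, varKL a)) ∧
    (∀ x : ℝ × ℝ, IsOptimal (sdObjective a b) x ↔ x = (meanSD a b, varSD a)) ∧
    (∀ x : ℝ × ℝ, IsLocallyOptimal (fdObjective a b) x ↔ x = (meanFD a b, varFD a)) ∧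
    (∀ x : ℝ × ℝ, IsOptimal (fdObjective a b) x ↔
      Real.sqrt (Real.exp 1) - 1 ≤ a ∧ x = (meanFD a b, varFD a)) ∧
    -- the orderings; a global minimizer of the Fisher divergence is in particular a local one
    (∀ (m μKL μF μS vKL vF vS : ℝ),
      IsMode (logInvGammaPDF a b) m →
      IsOptimal (klObjective a b) (μKL, vKL) →
      IsLocallyOptimal (fdObjective a b) (μF, vF) →
      IsOptimal (sdObjective a b) (μS, vS) →
      (vS < vF ∧ vF < vKL ∧ vKL < variance (fun θ : ℝ => θ) (logInvGamma a b)) ∧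
      (m < μS ∧ μS < μF ∧ μF < μKL ∧ μKL < ∫ θ, θ ∂(logInvGamma a b))) := by
  have ha0 : 0 < a := by linarith
  refine ⟨⟨map_log_inv_gammaMeasure a b, isProbabilityMeasure_logInvGamma ha0 hb,
    memLp_logInvGamma ha0 hb, Real.log (b / a), (isMode_logInvGammaPDF_iff ha0 hb _).2 rfl,
    fun m hm => (isMode_logInvGammaPDF_iff ha0 hb m).1 hm⟩,
    isOptimal_klObjective_iff ha0 hb, isOptimal_sdObjective_iff ha hb,
    isLocallyOptimal_fdObjective_iff ha hb, isOptimal_fdObjective_iff ha hb, ?_⟩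
  intro m μKL μF μS vKL vF vS hm hKL hF hS
  obtain ⟨rfl, rfl⟩ := Prod.mk.inj ((isOptimal_klObjective_iff ha0 hb _).1 hKL)
  obtain ⟨rfl, rfl⟩ := Prod.mk.inj ((isLocallyOptimal_fdObjective_iff ha hb _).1 hF)
  obtain ⟨rfl, rfl⟩ := Prod.mk.inj ((isOptimal_sdObjective_iff ha hb _).1 hS)
  obtain rfl := (isMode_logInvGammaPDF_iff ha0 hb m).1 hm
  exact ⟨⟨varSD_lt_varFD ha, varFD_lt_varKL ha, varKL_lt_variance ha0 hb⟩,
    log_div_lt_meanSD ha hb, meanSD_lt_meanFD ha, meanFD_lt_meanKL ha hb, meanKL_lt_integral ha0 hb⟩
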